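/- Let $d\ge 2$ and $1\le k\le d-1$ be integers. Let $\mathcal G_k$ be the set of $k$-planes ($k$-dimensional affine subspaces) of $\mathbb R^d$ and $\mathcal M_k\subset\mathcal G_k$ the set of $k$-planes containing $0$. Let $\mu_k$ be the probability measure on $\mathcal M_k$ that is invariant under orthogonal maps, and let $\sigma_k$ be the measure on $\mathcal G_k$ given by $$\sigma_k(A)=\int_{\mathcal M_k}\lambda\bigl(\{x\in W^\perp : x+W\in A\}\bigr)\,d\mu_k(W),$$ where $\lambda$ is the Lebesgue measure of the $(d-k)$-dimensional space $W^\perp$. For a nonnegative measurable function $f$ on $\mathbb R^d$ and $\Pi\in\mathcal G_k$ put $$\mathcal R_kf(\Pi)=\int_\Pi f\,d\lambda_\Pi\in[0,\infty],$$ where $\lambda_\Pi$ is the surface Lebesgue measure of $\Pi$. For $f:\mathbb R^d\to\mathbb R$ and $(u,s)\in\mathbb R^{d-1}\times(\mathbb R\setminus\{0\})$ put $$\mathcal Sf(u,s)=\frac1{|s|^{k+1}}\,f\Bigl(\frac us,\frac1s\Bigr),$$ which defines $\mathcal Sf$ almost everywhere on $\mathbb R^d$. Then: 1. $\mathcal S$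 induces a linear isometry of $L^{\frac{d+1}{k+1}}(\mathbb R^d)$ onto itself. 2. For every nonnegative measurable function $f$ on $\mathbb R^d$, $$\|\mathcal R_k\mathcal Sf\|_{L^{d+1}(\mathcal G_k,\sigma_k)}=\|\mathcal R_kf\|_{L^{d+1}(\mathcal G_k,\sigma_k)}$$ (an equality in $[0,\infty]$). -/

import Mathlib

open MeasureTheory MeasureTheory.Measure
open scoped ENNReal

namespace KPlane

/-- The Euclidean space `ℝ^d`. -/
abbrev E (d : ℕ) : Type := EuclideanSpace ℝ (Fin d)

/-- The orthogonal group `O(d)`, as the group of unitary elements of the real algebra of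
endomorphisms of `ℝ^d`. -/
abbrev O (d : ℕ) : Type := unitary (E d →L[ℝ] E d)

theorem continuousStar_clm (H : Type) [NormedAddCommGroup H] [InnerProductSpace ℝ H]
    [CompleteSpace H] : ContinuousStar (H →L[ℝ] H) := inferInstance

instance (d : ℕ) : ContinuousStar (E d →L[ℝ] E d) := continuousStar_clm (E d)

instance compactSpace_O (d : ℕ) : CompactSpace (O d) := by
  have hP : ProperSpace (E d →L[ℝ] E d) := FiniteDimensional.proper_real _
  refine isCompact_iff_compactSpace.mp
    (?_ : IsCompact ((unitary (E d →L[ℝ] E d) : Submonoid _) : Set (E d →L[ℝ] E d)))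
  refine Metric.isCompact_of_isClosed_isBounded isClosed_unitary ?_
  refine (Metric.isBounded_closedBall (x := (0 : E d →L[ℝ] E d)) (r := 1)).subset ?_
  intro u hu
  rw [mem_closedBall_zero_iff]
  refine ContinuousLinearMap.opNorm_le_bound _ zero_le_one fun x => ?_
  rw [ContinuousLinearMap.norm_map_of_mem_unitary hu, one_mul]

/-- The set `M_k` of all `k`-dimensional linear subspaces of `ℝ^d`. -/
def Gr (d k : ℕ) : Type := {W : Submodule ℝ (E d) // Module.finrank ℝ W = k}

/-- The Borel structure of the Grassmannian: a subspace is identified with the orthogonal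
projection onto it, an element of the finite-dimensional space of endomorphisms of `ℝ^d`. -/
noncomputable instance (d k : ℕ) : MeasurableSpace (Gr d k) :=
  MeasurableSpace.comap (fun W => W.1.starProjection) (inferInstance : MeasurableSpace
    (E d →L[ℝ] E d))

/-- The set `G_k` of all `k`-planes in `ℝ^d`, that is, of all (non-empty) affine subspaces of
dimension `k`. -/
def AffGr (d k : ℕ) : Type :=
  {P : AffineSubspace ℝ (E d) // (P : Set (E d)).Nonempty ∧ Module.finrank ℝ P.direction = k}

/-- The point of the `k`-plane `P` that is closest to the origin. -/
noncomputable def AffGr.foot {d k : ℕ} (P : AffGr d k) : E d :=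
  haveI : Nonempty P.1 := P.2.1.to_subtype
  (EuclideanGeometry.orthogonalProjection P.1 0 : P.1)

/-- The Borel structure of the set of `k`-planes: a plane is identified with the pair formed by
the orthogonal projection onto its direction and its point closest to the origin. -/
noncomputable instance (d k : ℕ) : MeasurableSpace (AffGr d k) :=
  MeasurableSpace.comap (fun P => (P.1.direction.starProjection, P.foot))
    (inferInstance : MeasurableSpace ((E d →L[ℝ] E d) × E d))

/-- The image `Ω W` of a `k`-dimensional linear subspace under an orthogonal map. -/
noncomputable def Gr.rotate {d k : ℕ} (Ω : O d) (W : Gr d k) : Gr d k :=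
  ⟨W.1.map (Unitary.linearIsometryEquiv Ω).toLinearEquiv.toLinearMap, by
    rw [LinearEquiv.finrank_map_eq, W.2]⟩

/-- The coordinate subspace spanned by the first `k` vectors of the standard basis of `ℝ^d`. -/
noncomputable def coordPlane {d k : ℕ} (h : k ≤ d) : Gr d k :=
  ⟨Submodule.span ℝ (Set.range fun i : Fin k => EuclideanSpace.single (Fin.castLE h i) (1 : ℝ)), by
    have h1 : LinearIndependent ℝ
        (fun i : Fin k => (EuclideanSpace.single (Fin.castLE h i) (1 : ℝ) : E d)) := by
      have h2 := (EuclideanSpace.basisFun (Fin d) ℝ).orthonormal.linearIndependent.comp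
        (Fin.castLE h) (Fin.castLE_injective h)
      simpa [Function.comp_def] using h2
    rw [finrank_span_eq_card h1, Fintype.card_fin]⟩

/-- The Haar probability measure of the orthogonal group. -/
noncomputable def haarO (d : ℕ) : Measure (O d) := haarMeasure ⊤

/-- The rotation-invariant probability measure `μ_k` on the Grassmannian: the law of `Ω W₀` for a
fixed `k`-dimensional subspace `W₀` and a Haar-distributed orthogonal map `Ω`. -/
noncomputable def grMeasure {d k : ℕ} (h : k ≤ d) : Measure (Gr d k) :=
  (haarO d).map fun Ω => Gr.rotate Ω (coordPlane h)

lemma starProjection_rotate {d k : ℕ} (Ω : O d) (W : Gr d k) :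
    (Gr.rotate Ω W).1.starProjection =
      (Ω : E d →L[ℝ] E d) * W.1.starProjection * (star Ω : E d →L[ℝ] E d) := by
  ext1 x
  exact Submodule.starProjection_map_apply (Unitary.linearIsometryEquiv Ω) W.1 x

lemma measurable_rotate {d k : ℕ} (W : Gr d k) : Measurable fun Ω : O d => Gr.rotate Ω W := by
  refine measurable_comap_iff.mpr ?_
  have hc : Continuous fun Ω : O d =>
      (Ω : E d →L[ℝ] E d) * W.1.starProjection * (star Ω : E d →L[ℝ] E d) := by
    fun_prop
  have he : (fun W : Gr d k => W.1.starProjection) ∘ (fun Ω : O d => Gr.rotate Ω W) =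
      fun Ω : O d =>
      (Ω : E d →L[ℝ] E d) * W.1.starProjection * (star Ω : E d →L[ℝ] E d) :=
    funext fun Ω => starProjection_rotate Ω W
  rw [he]
  exact hc.measurable

lemma measurable_rotate_left {d k : ℕ} (Ω : O d) :
    Measurable fun W : Gr d k => Gr.rotate Ω W := by
  refine measurable_comap_iff.mpr ?_
  have hc : Continuous fun p : E d →L[ℝ] E d =>
      (Ω : E d →L[ℝ] E d) * p * (star Ω : E d →L[ℝ] E d) := by
    fun_prop
  have hp : Measurable fun W : Gr d k => W.1.starProjection := comap_measurable _
  have he : (fun W : Gr d k => W.1.starProjection) ∘ (fun W : Gr d k => Gr.rotate Ω W) = fun W =>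
      (Ω : E d →L[ℝ] E d) * W.1.starProjection * (star Ω : E d →L[ℝ] E d) :=
    funext fun W => starProjection_rotate Ω W
  rw [he]
  exact hc.measurable.comp hp

lemma rotate_mul {d k : ℕ} (Ω Ω' : O d) (W : Gr d k) :
    Gr.rotate (Ω * Ω') W = Gr.rotate Ω (Gr.rotate Ω' W) := by
  refine Subtype.ext ?_
  change W.1.map _ = (W.1.map _).map _
  rw [← Submodule.map_comp, map_mul]
  rfl

instance isProbabilityMeasure_haarO (d : ℕ) : IsProbabilityMeasure (haarO d) :=
  ⟨by simpa [haarO] using haarMeasure_self (K₀ := (⊤ : TopologicalSpace.PositiveCompacts (O d)))⟩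

/-- `μ_k` is a probability measure. -/
theorem isProbabilityMeasure_grMeasure {d k : ℕ} (h : k ≤ d) :
    IsProbabilityMeasure (grMeasure h) :=
  isProbabilityMeasure_map (measurable_rotate _).aemeasurable

/-- `μ_k` is invariant under orthogonal maps. -/
theorem map_rotate_grMeasure {d k : ℕ} (h : k ≤ d) (Ω : O d) :
    (grMeasure h).map (Gr.rotate Ω) = grMeasure h := by
  have hl : (haarO d).map (fun Ω' => Ω * Ω') = haarO d := by
    unfold haarO
    exact map_mul_left_eq_self _ _
  unfold grMeasure
  rw [map_map (measurable_rotate_left Ω) (measurable_rotate _)]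
  conv_rhs => rw [← hl, map_map (measurable_rotate _) (measurable_const_mul Ω)]
  congr 1
  funext Ω'
  exact (rotate_mul Ω Ω' _).symm

/-- The `k`-plane `x + W`. -/
noncomputable def Gr.coset {d k : ℕ} (W : Gr d k) (x : E d) : AffGr d k :=
  ⟨AffineSubspace.mk' x W.1, AffineSubspace.mk'_nonempty x W.1, by
    rw [AffineSubspace.direction_mk', W.2]⟩

lemma foot_coset {d k : ℕ} (W : Gr d k) (x : E d) :
    (W.coset x).foot = x - W.1.starProjection x := by
  have : Nonempty (W.coset x).1 := (W.coset x).2.1.to_subtype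
  have hd : (W.coset x).1.direction = W.1 := AffineSubspace.direction_mk' x W.1
  refine EuclideanGeometry.coe_orthogonalProjection_eq_iff_mem.mpr ⟨?_, ?_⟩
  · refine (AffineSubspace.mem_mk').mpr ?_
    simp
  · rw [hd]
    simpa using W.1ᗮ.neg_mem (W.1.sub_starProjection_mem_orthogonal x)

lemma measurable_starProjection_apply (d k : ℕ) :
    Measurable fun q : Gr d k × E d => q.1.1.starProjection q.2 := by
  have hp : Measurable fun q : Gr d k × E d => q.1.1.starProjection :=
    (comap_measurable _ : Measurable fun W : Gr d k => W.1.starProjection).comp measurable_fst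
  have hc : Continuous fun q : (E d →L[ℝ] E d) × E d => q.1 q.2 := by fun_prop
  exact hc.measurable.comp (hp.prodMk measurable_snd)

lemma measurable_coset (d k : ℕ) :
    Measurable fun q : Gr d k × E d => q.1.coset q.2 := by
  refine measurable_comap_iff.mpr ?_
  have hp : Measurable fun q : Gr d k × E d => q.1.1.starProjection :=
    (comap_measurable _ : Measurable fun W : Gr d k => W.1.starProjection).comp measurable_fst
  have hf : Measurable fun q : Gr d k × E d => q.2 - q.1.1.starProjection q.2 :=
    measurable_snd.sub (measurable_starProjection_apply d k)
  have he : (fun P : AffGr d k => (P.1.direction.starProjection, P.foot)) ∘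
      (fun q : Gr d k × E d => q.1.coset q.2) =
      fun q => (q.1.1.starProjection, q.2 - q.1.1.starProjection q.2) := by
    funext q
    refine Prod.ext ?_ (foot_coset q.1 q.2)
    have hV : ∀ V V' : Submodule ℝ (E d), V = V' → V.starProjection = V'.starProjection := by
      rintro V _ rfl
      rfl
    exact hV _ _ (AffineSubspace.direction_mk' q.2 q.1.1)
  rw [he]
  exact hp.prodMk hf

lemma measurableSet_fiber {d k : ℕ} {A : Set (AffGr d k)} (hA : MeasurableSet A) (W : Gr d k) :
    MeasurableSet {x : W.1ᗮ | W.coset (x : E d) ∈ A} :=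
  (measurable_coset d k).comp (measurable_const.prodMk measurable_subtype_coe) hA

lemma coset_eq {d k : ℕ} (W : Gr d k) (z : E d) :
    W.coset (W.1ᗮ.orthogonalProjectionOnto z : E d) = W.coset z := by
  refine Subtype.ext ?_
  have hz : z ∈ (W.coset (W.1ᗮ.orthogonalProjectionOnto z : E d)).1 := by
    refine AffineSubspace.mem_mk'.mpr ?_
    have h := W.1ᗮ.sub_starProjection_mem_orthogonal z
    rwa [Submodule.orthogonal_orthogonal] at h
  have h := AffineSubspace.mk'_eq hz
  rw [← h]
  change AffineSubspace.mk' z (AffineSubspace.mk' _ W.1).direction = AffineSubspace.mk' z W.1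
  rw [AffineSubspace.direction_mk']

lemma volume_closedBall_gr {d k : ℕ} (W : Gr d k) :
    volume (Metric.closedBall (0 : W.1) 1) = volume (Metric.closedBall (0 : E k) 1) := by
  let e : W.1 ≃ₗᵢ[ℝ] E k := (stdOrthonormalBasis ℝ W.1).reindex (finCongr W.2) |>.repr
  rw [← e.measurePreserving.measure_preimage measurableSet_closedBall.nullMeasurableSet]
  congr 1
  ext y
  simp

lemma volume_slab {d k : ℕ} {A : Set (AffGr d k)} (hA : MeasurableSet A) (W : Gr d k) :
    volume {z : E d | W.coset z ∈ A ∧ ‖W.1.starProjection z‖ ≤ 1} =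
      volume (Metric.closedBall (0 : E k) 1) * volume {x : W.1ᗮ | W.coset (x : E d) ∈ A} := by
  have hv := W.1.measurePreserving_measurableEquivProd (0 : E d)
  rw [InnerProductSpace.euclideanHausdorffMeasure_eq_volume] at hv
  have key := hv.measure_preimage (s := Metric.closedBall (0 : W.1) 1 ×ˢ
    {x : W.1ᗮ | W.coset (x : E d) ∈ A})
    (measurableSet_closedBall.prod (measurableSet_fiber hA W)).nullMeasurableSet
  rw [volume_eq_prod, prod_prod, volume_closedBall_gr] at key
  rw [← key]
  congr 1
  ext z
  simp only [Set.mem_ofPred_eq, Set.mem_preimage, Set.mem_prod, mem_closedBall_zero_iff,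
    Submodule.measurableEquivProd_apply, vsub_eq_sub, sub_zero, coset_eq]
  exact and_comm

lemma measurableSet_slab {d k : ℕ} {A : Set (AffGr d k)} (hA : MeasurableSet A) :
    MeasurableSet {q : Gr d k × E d | q.1.coset q.2 ∈ A ∧ ‖q.1.1.starProjection q.2‖ ≤ 1} := by
  have h1 : MeasurableSet {q : Gr d k × E d | q.1.coset q.2 ∈ A} := measurable_coset d k hA
  have h2 : MeasurableSet {q : Gr d k × E d | ‖q.1.1.starProjection q.2‖ ≤ 1} :=
    measurableSet_le ((measurable_starProjection_apply d k).norm) measurable_const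
  exact h1.inter h2

lemma measurable_slab {d k : ℕ} {A : Set (AffGr d k)} (hA : MeasurableSet A) :
    Measurable fun W : Gr d k =>
      volume {z : E d | W.coset z ∈ A ∧ ‖W.1.starProjection z‖ ≤ 1} :=
  measurable_measure_prodMk_left (measurableSet_slab hA)

lemma measurable_fiber {d k : ℕ} {A : Set (AffGr d k)} (hA : MeasurableSet A) :
    Measurable fun W : Gr d k => volume {x : W.1ᗮ | W.coset (x : E d) ∈ A} := by
  have hc0 : volume (Metric.closedBall (0 : E k) 1) ≠ 0 :=
    (Metric.measure_closedBall_pos volume _ one_pos).ne'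
  have hct : volume (Metric.closedBall (0 : E k) 1) ≠ ∞ := measure_closedBall_lt_top.ne
  have he : ∀ W : Gr d k, volume {x : W.1ᗮ | W.coset (x : E d) ∈ A} =
      (volume (Metric.closedBall (0 : E k) 1))⁻¹ *
        volume {z : E d | W.coset z ∈ A ∧ ‖W.1.starProjection z‖ ≤ 1} := by
    intro W
    rw [volume_slab hA, ← mul_assoc, ENNReal.inv_mul_cancel hc0 hct, one_mul]
  simp only [he]
  exact (measurable_slab hA).const_mul _

/-- The invariant measure `σ_k` on the set of `k`-planes,
`σ_k(A) = ∫ λ({x ∈ Wᗮ : x + W ∈ A}) dμ_k(W)`, with `λ` the Lebesgue measure of the Euclidean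
space `Wᗮ`. -/
noncomputable def sigma {d k : ℕ} (h : k ≤ d) : Measure (AffGr d k) :=
  Measure.ofMeasurable
    (fun A _ => ∫⁻ W, volume {x : W.1ᗮ | W.coset (x : E d) ∈ A} ∂(grMeasure h))
    (by simp)
    (by
      intro A hA hd
      rw [← lintegral_tsum fun i => (measurable_fiber (hA i)).aemeasurable]
      refine lintegral_congr fun W => ?_
      have hm : Measurable fun x : W.1ᗮ => W.coset (x : E d) :=
        (measurable_coset d k).comp (measurable_const.prodMk measurable_subtype_coe)
      have hU : {x : W.1ᗮ | W.coset (x : E d) ∈ ⋃ i, A i} =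
          ⋃ i, {x : W.1ᗮ | W.coset (x : E d) ∈ A i} := by
        ext x; simp
      rw [hU]
      exact measure_iUnion (fun i j hij => (hd hij).preimage _) fun i => hm (hA i))

theorem sigma_apply {d k : ℕ} (h : k ≤ d) {A : Set (AffGr d k)} (hA : MeasurableSet A) :
    sigma h A = ∫⁻ W, volume {x : W.1ᗮ | W.coset (x : E d) ∈ A} ∂(grMeasure h) :=
  Measure.ofMeasurable_apply A hA

/-- The `k`-plane transform `R_k f(Π) = ∫_Π f dλ_Π` of a nonnegative function, with values in
`[0, ∞]`. Here `λ_Π` is the surface Lebesgue measure of `Π`, that is, the restriction to `Π` of the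
`k`-dimensional Hausdorff measure, normalized so as to be the Lebesgue measure on `ℝ^k`. -/
noncomputable def transform {d k : ℕ} (f : E d → ℝ≥0∞) (P : AffGr d k) : ℝ≥0∞ :=
  ∫⁻ x in (P.1 : Set (E d)), f x ∂(euclideanHausdorffMeasure k)

/-- The map `(u, s) ↦ (u / s, 1 / s)` of `ℝ^n × (ℝ ∖ {0})`, in `ℝ^(n+1) = ℝ^n × ℝ`. -/
noncomputable def inversion {n : ℕ} (x : E (n + 1)) : E (n + 1) :=
  WithLp.toLp 2 (Fin.snoc (α := fun _ => ℝ) (fun i : Fin n => x i.castSucc / x (Fin.last n))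
    (1 / x (Fin.last n)))

/-- The operator `S f (u, s) = |s|^(-(k+1)) f(u / s, 1 / s)`, for `(u, s) ∈ ℝ^n × (ℝ ∖ {0})`. (On
the null set `s = 0`, where the formula means nothing, the value here is `0`.) -/
noncomputable def S {n : ℕ} (k : ℕ) (f : E (n + 1) → ℝ) (x : E (n + 1)) : ℝ :=
  1 / |x (Fin.last n)| ^ (k + 1) * f (inversion x)

/-- The exponent `p = (d + 1) / (k + 1)`. -/
noncomputable def pExp (d k : ℕ) : ℝ≥0∞ := ((d : ℝ≥0∞) + 1) / ((k : ℝ≥0∞) + 1)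

lemma one_le_pExp {d k : ℕ} (h : k ≤ d) : 1 ≤ pExp d k := by
  unfold pExp
  rw [ENNReal.le_div_iff_mul_le (by simp) (by simp), one_mul]
  gcongr

end KPlane

namespace KPlane

/-! ### The span of a tuple of vectors as a point of the Grassmannian -/

/-! Write `d = k + m` and describe almost every `k`-plane as a graph `{(y, A y + b) : y ∈ ℝ^k}`,
with `k` columns `A i ∈ ℝ^m` and `b ∈ ℝ^m`. Let `J(A)` be the area factor of `y ↦ (y, A y)`. Then
`R_k f = J(A) F(A, b)`, where `F(A, b) = ∫ f(y, A y + b) dy`, while `σ_k` becomes `c J(A)^(-(d+1))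
dA db`. The powers of `J` cancel exactly for the exponent `d + 1`, so `∫ (R_k f)^(d+1) dσ_k = c ∫∫
F^(d+1) dA db` (`lintegral_transform_pow`).

For the density, uniqueness of the invariant measure identifies `μ_k`, up to a constant, with the
law of the span of a Lebesgue-distributed frame in the unit ball (`map_spanGr`). Writing the frame
as `X j = (g j, A (g j))` costs `|det g|^m`, and integrating out `g` leaves `J(A)^(-d)`
(`frameIntegral_comp`). The measure transverse to the plane gives one more factor `J(A)^(-1)`
(`slabIntegral_graph`).

Let `s` be the last coordinate of `y`, and `a` the last column of `A`. Dividing `A' y' + s a + b` by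
`s` gives `A' (y'/s) + a + (1/s) b`: the inversion interchanges `a` and `b`. The weight
`|s|^(-(k+1))` is the Jacobian of the inversion of `ℝ^k`, so passing from `f` to `S f` only swaps
`a` and `b` in `F` (`graphTransform_SENN`), which leaves the integral `dA db` unchanged.

The first claim is the same change of variables on `ℝ^d`, with Jacobian `|s|^(-(d+1))`
(`lintegral_SENN`), together with the fact that `S` is an involution almost everywhere (`S_S`). -/

open Classical in
/-- The span of `k` vectors, as a point of the Grassmannian (a coordinate plane if the vectors are
linearly dependent). -/
noncomputable def spanGr {d k : ℕ} (h : k ≤ d) (X : Fin k → E d) : Gr d k :=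
  if hX : LinearIndependent ℝ X then
    ⟨Submodule.span ℝ (Set.range X), by rw [finrank_span_eq_card hX, Fintype.card_fin]⟩
  else coordPlane h

lemma spanGr_of_linearIndependent {d k : ℕ} (h : k ≤ d) {X : Fin k → E d}
    (hX : LinearIndependent ℝ X) : (spanGr h X).1 = Submodule.span ℝ (Set.range X) := by
  simp [spanGr, hX]

lemma continuous_gram {d k : ℕ} : Continuous fun X : Fin k → E d => Matrix.gram ℝ X :=
  continuous_matrix fun i j => by
    simp only [Matrix.gram_apply]
    fun_prop

lemma isOpen_linearIndependent {d k : ℕ} : IsOpen {X : Fin k → E d | LinearIndependent ℝ X} := by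
  simp only [← Matrix.det_gram_ne_zero_iff_linearIndependent]
  exact isOpen_ne_fun continuous_gram.matrix_det continuous_const

/-- The orthogonal projection onto the span of linearly independent vectors, by means of their
Gram matrix. -/
lemma starProjection_span_eq_sum {d k : ℕ} {X : Fin k → E d} (hX : LinearIndependent ℝ X) :
    (Submodule.span ℝ (Set.range X)).starProjection =
      ∑ i, ∑ j, (Matrix.gram ℝ X)⁻¹ i j • InnerProductSpace.rankOne ℝ (X i) (X j) := by
  have hdet : IsUnit (Matrix.gram ℝ X).det :=
    (Matrix.det_gram_ne_zero_iff_linearIndependent.mpr hX).isUnit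
  ext1 z
  have hz : (∑ i, ∑ j, (Matrix.gram ℝ X)⁻¹ i j • InnerProductSpace.rankOne ℝ (X i) (X j)) z =
      ∑ i, ((Matrix.gram ℝ X)⁻¹.mulVec fun j => inner ℝ (X j) z) i • X i := by
    simp [Matrix.mulVec, dotProduct, Finset.sum_smul, smul_smul]
  rw [hz]
  -- The sum lies in the span. That the residual is orthogonal to each `X l` is the normal equation:
  -- the Gram matrix applied to the coefficients returns `⟨X l, z⟩`.
  refine Submodule.eq_starProjection_of_mem_of_inner_eq_zero
    (Submodule.sum_mem _ fun i _ => Submodule.smul_mem _ _ (Submodule.subset_span ⟨i, rfl⟩)) ?_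
  intro w hw
  induction hw using Submodule.span_induction with
  | zero => simp
  | add x y _ _ hx hy => rw [inner_add_right, hx, hy, add_zero]
  | smul a x _ hx => rw [inner_smul_right, hx, mul_zero]
  | mem x hx =>
    obtain ⟨l, rfl⟩ := hx
    have h1 : (Matrix.gram ℝ X).mulVec
        ((Matrix.gram ℝ X)⁻¹.mulVec fun j => inner ℝ (X j) z) l = inner ℝ (X l) z := by
      rw [Matrix.mulVec_mulVec, Matrix.mul_nonsing_inv _ hdet, Matrix.one_mulVec]
    rw [inner_sub_left, real_inner_comm, ← h1, sum_inner, sub_eq_zero, Matrix.mulVec, dotProduct]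
    refine Finset.sum_congr rfl fun i _ => ?_
    rw [inner_smul_left, Matrix.gram_apply, real_inner_comm]
    simp [mul_comm]

lemma continuous_rankOne {d : ℕ} :
    Continuous fun q : E d × E d => InnerProductSpace.rankOne ℝ q.1 q.2 :=
  (InnerProductSpace.rankOne ℝ (E := E d) (F := E d)).continuous₂

/-- Measurability into the Grassmannian is that of the projection, whose entries are rational in `X`
by the Gram formula on the open set of independent tuples, and constant off it. -/
lemma measurable_spanGr {d k : ℕ} (h : k ≤ d) : Measurable (spanGr h) := by
  refine measurable_comap_iff.mpr ?_
  have hinv : ∀ i j, Measurable fun X : Fin k → E d => (Matrix.gram ℝ X)⁻¹ i j := by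
    intro i j
    simp only [Matrix.inv_def, Ring.inverse_eq_inv', Matrix.smul_apply, smul_eq_mul]
    refine (continuous_gram.matrix_det.measurable.inv).mul ?_
    exact ((continuous_apply_apply i j).comp continuous_gram.matrix_adjugate).measurable
  have hQ : Measurable fun X : Fin k → E d =>
      ∑ i, ∑ j, (Matrix.gram ℝ X)⁻¹ i j • InnerProductSpace.rankOne ℝ (X i) (X j) := by
    refine Finset.measurable_sum _ fun i _ => Finset.measurable_sum _ fun j _ => ?_
    have hr : Continuous fun X : Fin k → E d => InnerProductSpace.rankOne ℝ (X i) (X j) :=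
      Continuous.comp (g := fun q : E d × E d => InnerProductSpace.rankOne ℝ q.1 q.2)
        (f := fun X : Fin k → E d => (X i, X j)) continuous_rankOne
        ((continuous_apply i).prodMk (continuous_apply j))
    exact (hinv i j).smul hr.measurable
  classical
  have he : (fun W : Gr d k => W.1.starProjection) ∘ spanGr h = fun X =>
      if X ∈ {X : Fin k → E d | LinearIndependent ℝ X} then
        ∑ i, ∑ j, (Matrix.gram ℝ X)⁻¹ i j • InnerProductSpace.rankOne ℝ (X i) (X j)
      else (coordPlane h).1.starProjection := by
    funext X
    by_cases hX : LinearIndependent ℝ X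
    · simp only [Function.comp_apply, Set.mem_ofPred_eq, hX, if_true]
      rw [← starProjection_span_eq_sum hX]
      simp [spanGr, hX]
    · simp [spanGr, hX]
  rw [he]
  exact Measurable.ite isOpen_linearIndependent.measurableSet hQ measurable_const

/-! ### Uniqueness of the invariant measure of the Grassmannian -/

lemma measurable_rotate_uncurry (d k : ℕ) :
    Measurable fun q : O d × Gr d k => Gr.rotate q.1 q.2 := by
  refine measurable_comap_iff.mpr ?_
  have hc : Continuous fun q : O d × (E d →L[ℝ] E d) =>
      (q.1 : E d →L[ℝ] E d) * q.2 * (star q.1 : E d →L[ℝ] E d) := by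
    fun_prop
  have he : (fun W : Gr d k => W.1.starProjection) ∘ (fun q : O d × Gr d k => Gr.rotate q.1 q.2) =
      fun q => (q.1 : E d →L[ℝ] E d) * q.2.1.starProjection * (star q.1 : E d →L[ℝ] E d) :=
    funext fun q => starProjection_rotate q.1 q.2
  rw [he]
  exact hc.measurable.comp (measurable_fst.prodMk ((comap_measurable _ : Measurable
    fun W : Gr d k => W.1.starProjection).comp measurable_snd))

/-- The orthogonal group acts transitively on the Grassmannian. -/
lemma exists_rotate_eq {d k : ℕ} (W W' : Gr d k) : ∃ Ω : O d, Gr.rotate Ω W = W' := by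
  let e : W.1 ≃ₗᵢ[ℝ] W'.1 :=
    (stdOrthonormalBasis ℝ W.1).equiv (stdOrthonormalBasis ℝ W'.1)
      (finCongr (W.2.trans W'.2.symm))
  -- An isometry between the two subspaces extends to the whole space, where equality of dimensions
  -- makes it onto.
  let L : E d →ₗᵢ[ℝ] E d := (W'.1.subtypeₗᵢ.comp e.toLinearIsometry).extend
  let U : E d ≃ₗᵢ[ℝ] E d := L.toLinearIsometryEquiv rfl
  refine ⟨Unitary.linearIsometryEquiv.symm U, Subtype.ext ?_⟩
  refine Submodule.eq_of_le_of_finrank_eq ?_ ?_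
  · rintro _ ⟨x, hx, rfl⟩
    have h1 : L x = e ⟨x, hx⟩ := LinearIsometry.extend_apply _ ⟨x, hx⟩
    have h2 : (Unitary.linearIsometryEquiv (Unitary.linearIsometryEquiv.symm U)) x = L x := by
      rw [MulEquiv.apply_symm_apply]; rfl
    change (Unitary.linearIsometryEquiv (Unitary.linearIsometryEquiv.symm U)) x ∈ _
    rw [h2, h1]
    exact (e ⟨x, hx⟩).2
  · rw [(Gr.rotate _ W).2, W'.2]

/-- The integral against a rotation-invariant measure of the Grassmannian. -/
lemma lintegral_eq_of_invariant {d k : ℕ} {ν : Measure (Gr d k)} [SFinite ν]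
    (hν : ∀ Ω : O d, ν.map (Gr.rotate Ω) = ν) (W₀ : Gr d k) {Φ : Gr d k → ℝ≥0∞}
    (hΦ : Measurable Φ) :
    ∫⁻ W, Φ W ∂ν = ν Set.univ * ∫⁻ Ω, Φ (Gr.rotate Ω⁻¹ W₀) ∂(haarO d) := by
  have hm : Measurable fun q : O d × Gr d k => Φ (Gr.rotate q.1⁻¹ q.2) := by
    have hc : Continuous fun Ω : O d => Ω⁻¹ := continuous_inv
    have hi : Measurable fun q : O d × Gr d k => (q.1⁻¹, q.2) :=
      (hc.measurable.comp measurable_fst).prodMk measurable_snd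
    exact (hΦ.comp (measurable_rotate_uncurry d k)).comp
      (f := fun q : O d × Gr d k => (q.1⁻¹, q.2)) hi
  have h1 : ∀ Ω : O d, ∫⁻ W, Φ (Gr.rotate Ω⁻¹ W) ∂ν = ∫⁻ W, Φ W ∂ν := fun Ω => by
    conv_rhs => rw [← hν Ω⁻¹, lintegral_map hΦ (measurable_rotate_left _)]
  have h2 : ∫⁻ W, Φ W ∂ν = ∫⁻ Ω, ∫⁻ W, Φ (Gr.rotate Ω⁻¹ W) ∂ν ∂(haarO d) := by
    simp [h1]
  -- The average over `Ω` does not depend on `W`: for `W = Ω₀ W₀` substitute `Ω₀ Ω` for `Ω`. Because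
  -- of the inverse in the integrand, left invariance of Haar measure is enough.
  have h3 : ∀ W : Gr d k, ∫⁻ Ω, Φ (Gr.rotate Ω⁻¹ W) ∂(haarO d) =
      ∫⁻ Ω, Φ (Gr.rotate Ω⁻¹ W₀) ∂(haarO d) := by
    intro W
    obtain ⟨Ω₀, rfl⟩ := exists_rotate_eq W₀ W
    have hl : (haarO d).map (fun Ω => Ω₀ * Ω) = haarO d := by
      unfold haarO
      exact map_mul_left_eq_self _ _
    have hm' : Measurable fun Ω : O d => Φ (Gr.rotate Ω⁻¹ (Gr.rotate Ω₀ W₀)) :=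
      hm.comp (f := fun Ω : O d => (Ω, Gr.rotate Ω₀ W₀)) (measurable_id.prodMk measurable_const)
    conv_lhs => rw [← hl, lintegral_map hm' (measurable_const_mul Ω₀)]
    refine lintegral_congr fun Ω => ?_
    rw [← rotate_mul]
    simp
  rw [h2, lintegral_lintegral_swap hm.aemeasurable]
  simp [h3, mul_comm]

/-- Any invariant measure integrates `Φ` to its total mass times one and the same Haar integral, and
`μ_k` has mass one. -/
lemma eq_smul_grMeasure_of_invariant {d k : ℕ} (h : k ≤ d) {ν : Measure (Gr d k)} [SFinite ν]
    (hν : ∀ Ω : O d, ν.map (Gr.rotate Ω) = ν) : ν = ν Set.univ • grMeasure h := by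
  have := isProbabilityMeasure_grMeasure h
  ext A hA
  have hi : Measurable (A.indicator (1 : Gr d k → ℝ≥0∞)) := measurable_one.indicator hA
  rw [Measure.smul_apply, smul_eq_mul, ← lintegral_indicator_one hA, ← lintegral_indicator_one hA,
    lintegral_eq_of_invariant hν (coordPlane h) hi,
    lintegral_eq_of_invariant (map_rotate_grMeasure h) (coordPlane h) hi,
    measure_univ (μ := grMeasure h), one_mul]

/-! ### The span of random vectors -/

/-- The linearly independent `k`-tuples of vectors of norm at most one. -/
def unitFrames (d k : ℕ) : Set (Fin k → E d) :=
  {X | LinearIndependent ℝ X ∧ ∀ j, ‖X j‖ ≤ 1}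

lemma measurableSet_unitFrames (d k : ℕ) : MeasurableSet (unitFrames d k) := by
  have h1 : MeasurableSet {X : Fin k → E d | ∀ j, ‖X j‖ ≤ 1} := by
    rw [Set.ofPred_forall]
    exact MeasurableSet.iInter fun j =>
      measurableSet_le (measurable_pi_apply j).norm measurable_const
  exact isOpen_linearIndependent.measurableSet.inter h1

lemma volume_unitFrames_ne_top (d k : ℕ) : volume (unitFrames d k) ≠ ∞ := by
  refine (lt_of_le_of_lt (measure_mono fun X hX => ?_)
    (measure_closedBall_lt_top (x := (0 : Fin k → E d)) (r := 1))).ne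
  rw [mem_closedBall_zero_iff]
  exact (pi_norm_le_iff_of_nonneg zero_le_one).mpr hX.2

lemma volume_unitFrames_ne_zero {d k : ℕ} (h : k ≤ d) : volume (unitFrames d k) ≠ 0 := by
  have ho : IsOpen {X : Fin k → E d | LinearIndependent ℝ X ∧ ∀ j, ‖X j‖ < 1} := by
    have h1 : IsOpen {X : Fin k → E d | ∀ j, ‖X j‖ < 1} := by
      rw [Set.ofPred_forall]
      exact isOpen_iInter_of_finite fun j =>
        isOpen_lt (continuous_apply j).norm continuous_const
    exact isOpen_linearIndependent.inter h1
  have hne : {X : Fin k → E d | LinearIndependent ℝ X ∧ ∀ j, ‖X j‖ < 1}.Nonempty := by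
    -- The factor `1/2` moves the standard basis vectors into the open unit ball, as an open set is
    -- needed for positive measure.
    refine ⟨fun i => (2 : ℝ)⁻¹ • EuclideanSpace.single (Fin.castLE h i) (1 : ℝ), ?_, fun j => ?_⟩
    · have h2 := (EuclideanSpace.basisFun (Fin d) ℝ).orthonormal.linearIndependent.comp
        (Fin.castLE h) (Fin.castLE_injective h)
      have h3 := h2.units_smul fun _ => (Units.mk0 (2 : ℝ)⁻¹ (by norm_num))
      simpa [Function.comp_def, Pi.smul_def', Units.smul_def] using h3
    · rw [norm_smul]
      norm_num
  refine fun h0 => (ho.measure_pos volume hne).ne' (measure_mono_null (fun X hX => ?_) h0)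
  exact ⟨hX.1, fun j => (hX.2 j).le⟩

lemma spanGr_rotate {d k : ℕ} (h : k ≤ d) (Ω : O d) {X : Fin k → E d}
    (hX : LinearIndependent ℝ X) :
    spanGr h (fun j => Unitary.linearIsometryEquiv Ω (X j)) = Gr.rotate Ω (spanGr h X) := by
  have hX' : LinearIndependent ℝ fun j => Unitary.linearIsometryEquiv Ω (X j) :=
    hX.map' (Unitary.linearIsometryEquiv Ω).toLinearEquiv.toLinearMap
      (LinearEquiv.ker (Unitary.linearIsometryEquiv Ω).toLinearEquiv)
  refine Subtype.ext ?_
  change _ = (spanGr h X).1.map _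
  rw [spanGr_of_linearIndependent h hX, spanGr_of_linearIndependent h hX', Submodule.map_span,
    ← Set.range_comp]
  rfl

/-- Up to a constant, the span of independent random vectors of the unit ball has the
rotation-invariant law. -/
lemma map_spanGr {d k : ℕ} (h : k ≤ d) :
    (volume.restrict (unitFrames d k)).map (spanGr h) =
      volume (unitFrames d k) • grMeasure h := by
  -- Cutting off at the unit ball makes the law of the frame finite without breaking its invariance
  -- under rotations.
  have : IsFiniteMeasure (volume.restrict (unitFrames d k)) :=
    ⟨by simpa using (volume_unitFrames_ne_top d k).lt_top⟩
  rw [eq_smul_grMeasure_of_invariant h (ν := (volume.restrict (unitFrames d k)).map (spanGr h)),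
    map_apply (measurable_spanGr h) MeasurableSet.univ]
  · simp
  intro Ω
  rw [map_map (measurable_rotate_left Ω) (measurable_spanGr h)]
  let U := Unitary.linearIsometryEquiv Ω
  have hU : MeasurePreserving (fun (X : Fin k → E d) j => U (X j)) volume volume :=
    volume_preserving_pi fun _ => U.measurePreserving
  have hpre : (fun (X : Fin k → E d) j => U (X j)) ⁻¹' unitFrames d k = unitFrames d k := by
    ext X
    have hli : LinearIndependent ℝ (fun j => U (X j)) ↔ LinearIndependent ℝ X :=
      LinearMap.linearIndependent_iff U.toLinearEquiv.toLinearMap (LinearEquiv.ker U.toLinearEquiv)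
    simp [unitFrames, hli]
  have hr := hU.restrict_preimage (measurableSet_unitFrames d k)
  rw [hpre] at hr
  conv_rhs => rw [← hr.map_eq, map_map (measurable_spanGr h) hr.measurable]
  refine map_congr ?_
  filter_upwards [ae_restrict_mem (measurableSet_unitFrames d k)] with X hX
  exact (spanGr_rotate h Ω hX.1).symm

lemma lintegral_grMeasure_eq {d k : ℕ} (h : k ≤ d) {Φ : Gr d k → ℝ≥0∞} (hΦ : Measurable Φ) :
    volume (unitFrames d k) * ∫⁻ W, Φ W ∂(grMeasure h) =
      ∫⁻ X in unitFrames d k, Φ (spanGr h X) := by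
  rw [← lintegral_map hΦ (measurable_spanGr h), map_spanGr, lintegral_smul_measure, smul_eq_mul]

/-! ### The measure `σ_k` by means of slabs -/

/-- The integral of `H (z + W)` over the slab of all points `z` whose projection onto `W` has norm
at most one. -/
noncomputable def slabIntegral {d k : ℕ} (H : AffGr d k → ℝ≥0∞) (W : Gr d k) : ℝ≥0∞ :=
  ∫⁻ z in {z : E d | ‖W.1.starProjection z‖ ≤ 1}, H (W.coset z)

lemma measurableSet_norm_starProjection_le (d k : ℕ) :
    MeasurableSet {q : Gr d k × E d | ‖q.1.1.starProjection q.2‖ ≤ 1} :=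
  measurableSet_le ((measurable_starProjection_apply d k).norm) measurable_const

lemma measurableSet_slab_section {d k : ℕ} (W : Gr d k) :
    MeasurableSet {z : E d | ‖W.1.starProjection z‖ ≤ 1} :=
  measurableSet_le (by fun_prop) measurable_const

lemma slabIntegral_eq {d k : ℕ} (H : AffGr d k → ℝ≥0∞) (W : Gr d k) :
    slabIntegral H W = ∫⁻ z, {q : Gr d k × E d | ‖q.1.1.starProjection q.2‖ ≤ 1}.indicator
      (fun q => H (q.1.coset q.2)) (W, z) := by
  rw [slabIntegral, ← lintegral_indicator (measurableSet_slab_section W)]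
  rfl

lemma measurable_slabIntegrand {d k : ℕ} {H : AffGr d k → ℝ≥0∞} (hH : Measurable H) :
    Measurable ({q : Gr d k × E d | ‖q.1.1.starProjection q.2‖ ≤ 1}.indicator
      fun q => H (q.1.coset q.2)) :=
  (hH.comp (measurable_coset d k)).indicator (measurableSet_norm_starProjection_le d k)

lemma measurable_slabIntegral {d k : ℕ} {H : AffGr d k → ℝ≥0∞} (hH : Measurable H) :
    Measurable (slabIntegral H) := by
  have h := (measurable_slabIntegrand hH).lintegral_prod_right' (ν := (volume : Measure (E d)))
  convert h using 1
  funext W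
  exact slabIntegral_eq H W

/-- By Fubini on `W ⊕ Wᗮ`, the slab counts each coset of `W` with the volume of the unit ball of
`W`. This replaces the spaces `Wᗮ`, which vary with `W`, by the fixed space `ℝ^d`. -/
lemma lintegral_sigma_eq {d k : ℕ} (h : k ≤ d) {H : AffGr d k → ℝ≥0∞} (hH : Measurable H) :
    volume (Metric.closedBall (0 : E k) 1) * ∫⁻ P, H P ∂(sigma h) =
      ∫⁻ W, slabIntegral H W ∂(grMeasure h) := by
  have := isProbabilityMeasure_grMeasure h
  have hs := measurableSet_norm_starProjection_le d k
  have hmeas : volume (Metric.closedBall (0 : E k) 1) • sigma h =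
      (((grMeasure h).prod (volume : Measure (E d))).restrict
        {q : Gr d k × E d | ‖q.1.1.starProjection q.2‖ ≤ 1}).map
        fun q : Gr d k × E d => q.1.coset q.2 := by
    ext A hA
    rw [Measure.smul_apply, smul_eq_mul, sigma_apply h hA, map_apply (measurable_coset d k) hA,
      restrict_apply (measurable_coset d k hA)]
    change _ = ((grMeasure h).prod volume)
      {q : Gr d k × E d | q.1.coset q.2 ∈ A ∧ ‖q.1.1.starProjection q.2‖ ≤ 1}
    rw [prod_apply (measurableSet_slab hA), ← lintegral_const_mul _ (measurable_fiber hA)]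
    refine lintegral_congr fun W => ?_
    rw [← volume_slab hA W]
    rfl
  rw [← smul_eq_mul, ← lintegral_smul_measure, hmeas, lintegral_map hH (measurable_coset d k),
    ← lintegral_indicator hs, lintegral_prod _ (measurable_slabIntegrand hH).aemeasurable]
  exact lintegral_congr fun W => (slabIntegral_eq H W).symm

/-! ### The transform as an integral over the direction -/

lemma coe_coset {d k : ℕ} (W : Gr d k) (x : E d) :
    ((W.coset x).1 : Set (E d)) = {z | z - x ∈ W.1} := by
  ext z
  simp [Gr.coset, AffineSubspace.mem_mk', vsub_eq_sub]

lemma AffGr.eq_coset {d k : ℕ} (P : AffGr d k) {x : E d} (hx : x ∈ P.1) :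
    P = Gr.coset ⟨P.1.direction, P.2.2⟩ x :=
  Subtype.ext (AffineSubspace.mk'_eq hx).symm

lemma AffGr.foot_mem {d k : ℕ} (P : AffGr d k) : P.foot ∈ P.1 := by
  have : Nonempty P.1 := P.2.1.to_subtype
  exact (EuclideanGeometry.orthogonalProjection P.1 0 : P.1).2

/-- Hausdorff measure is carried along isometries. The parameter space `F` is left free so that it
can be either the subspace `W` itself or `ℝ^k`. -/
lemma transform_coset {d k : ℕ} {F : Type*} [NormedAddCommGroup F] [InnerProductSpace ℝ F]
    [FiniteDimensional ℝ F] [MeasurableSpace F] [BorelSpace F] (f : E d → ℝ≥0∞) (W : Gr d k)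
    (V : F →ₗᵢ[ℝ] E d) (hV : LinearMap.range V.toLinearMap = W.1) (x : E d) :
    transform f (W.coset x) = ∫⁻ y, f (x + V y) := by
  have hk : Module.finrank ℝ F = k := by
    rw [← LinearMap.finrank_range_of_inj (f := V.toLinearMap) V.injective, hV, W.2]
  have hi : Isometry fun y => x + V y := (isometry_add_left x).comp V.isometry
  have hr : ((W.coset x).1 : Set (E d)) = Set.range fun y => x + V y := by
    rw [coe_coset, ← hV]
    ext z
    constructor
    · rintro ⟨y, hy⟩
      exact ⟨y, by change V y = z - x at hy; simp [hy]⟩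
    · rintro ⟨y, rfl⟩
      exact ⟨y, by simp⟩
  rw [transform, hr, ← hi.map_euclideanHausdorffMeasure,
    hi.isClosedEmbedding.measurableEmbedding.lintegral_map, ← hk,
    InnerProductSpace.euclideanHausdorffMeasure_eq_volume]

lemma finrank_orthogonal {d k : ℕ} (W : Gr d k) : Module.finrank ℝ W.1ᗮ = d - k := by
  have h := W.1.finrank_add_finrank_orthogonal
  rw [W.2, finrank_euclideanSpace_fin] at h
  omega

/-- The plane is thickened by the unit ball of `Wᗮ`, so that the integral runs over the fixed space
`ℝ^d` and the plane enters only through its projection and its foot. These two generate the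
measurable structure on planes, whence `measurable_transform`. -/
lemma transform_eq_lintegral {d k : ℕ} {f : E d → ℝ≥0∞} (hf : Measurable f) (P : AffGr d k) :
    volume (Metric.closedBall (0 : E (d - k)) 1) * transform f P =
      ∫⁻ z in {z : E d | ‖z - P.1.direction.starProjection z‖ ≤ 1},
        f (P.foot + P.1.direction.starProjection z) := by
  let W : Gr d k := ⟨P.1.direction, P.2.2⟩
  have hv := W.1.measurePreserving_measurableEquivProd (0 : E d)
  rw [InnerProductSpace.euclideanHausdorffMeasure_eq_volume] at hv
  have h1 : transform f P = ∫⁻ w : W.1, f (P.foot + w) := by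
    conv_lhs => rw [P.eq_coset P.foot_mem]
    exact transform_coset f W W.1.subtypeₗᵢ (by ext; simp) P.foot
  have hG : Measurable ((Set.univ ×ˢ Metric.closedBall (0 : W.1ᗮ) 1).indicator
      fun q : W.1 × W.1ᗮ => f (P.foot + q.1)) := by
    refine Measurable.indicator ?_ (MeasurableSet.univ.prod measurableSet_closedBall)
    exact hf.comp (measurable_const.add (measurable_subtype_coe.comp measurable_fst))
  have hs : MeasurableSet {z : E d | ‖z - P.1.direction.starProjection z‖ ≤ 1} :=
    measurableSet_le (by fun_prop) measurable_const
  have h2 := hv.lintegral_comp hG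
  rw [volume_eq_prod, lintegral_prod _ hG.aemeasurable] at h2
  rw [h1, ← lintegral_indicator hs, ← volume_closedBall_gr ⟨W.1ᗮ, finrank_orthogonal W⟩, mul_comm,
    ← lintegral_mul_const]
  · refine Eq.trans ?_ (h2.symm.trans ?_)
    · refine lintegral_congr fun w => ?_
      rw [← lintegral_indicator_one (μ := volume) measurableSet_closedBall,
        ← lintegral_const_mul _ (measurable_one.indicator measurableSet_closedBall)]
      refine lintegral_congr fun u => ?_
      by_cases hu : u ∈ Metric.closedBall (0 : W.1ᗮ) 1 <;> simp [Set.indicator, hu]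
    · refine lintegral_congr fun z => ?_
      have hz : ((W.1ᗮ.orthogonalProjectionOnto z : W.1ᗮ) : E d) = z - W.1.starProjection z := by
        change W.1ᗮ.starProjection z = _
        rw [Submodule.starProjection_orthogonal']
        simp
      have hz' : ‖W.1ᗮ.orthogonalProjectionOnto z‖ = ‖z - W.1.starProjection z‖ := by
        rw [← hz]; rfl
      simp only [Set.indicator, Set.mem_prod, Set.mem_univ, true_and, mem_closedBall_zero_iff,
        Submodule.measurableEquivProd_apply, vsub_eq_sub, sub_zero, hz', Set.mem_ofPred_eq]
      rfl
  · exact hf.comp (measurable_const.add measurable_subtype_coe)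

lemma measurable_transform {d k : ℕ} {f : E d → ℝ≥0∞} (hf : Measurable f) :
    Measurable (transform f : AffGr d k → ℝ≥0∞) := by
  have hc0 : volume (Metric.closedBall (0 : E (d - k)) 1) ≠ 0 :=
    (Metric.measure_closedBall_pos volume _ one_pos).ne'
  have hct : volume (Metric.closedBall (0 : E (d - k)) 1) ≠ ∞ := measure_closedBall_lt_top.ne
  let G : ((E d →L[ℝ] E d) × E d) × E d → ℝ≥0∞ :=
    {q : ((E d →L[ℝ] E d) × E d) × E d | ‖q.2 - q.1.1 q.2‖ ≤ 1}.indicator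
      fun q => f (q.1.2 + q.1.1 q.2)
  have hG : Measurable G := by
    have hc : Continuous fun q : ((E d →L[ℝ] E d) × E d) × E d => q.1.1 q.2 := by fun_prop
    refine Measurable.indicator ?_ ?_
    · exact hf.comp ((measurable_snd.comp measurable_fst).add hc.measurable)
    · exact measurableSet_le (measurable_snd.sub hc.measurable).norm measurable_const
  have he : (transform f : AffGr d k → ℝ≥0∞) = fun P =>
      (volume (Metric.closedBall (0 : E (d - k)) 1))⁻¹ *
        ∫⁻ z, G ((P.1.direction.starProjection, P.foot), z) := by
    funext P
    have hs : MeasurableSet {z : E d | ‖z - P.1.direction.starProjection z‖ ≤ 1} :=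
      measurableSet_le (by fun_prop) measurable_const
    have h1 : ∫⁻ z, G ((P.1.direction.starProjection, P.foot), z) =
        volume (Metric.closedBall (0 : E (d - k)) 1) * transform f P := by
      rw [transform_eq_lintegral hf, ← lintegral_indicator hs]
      rfl
    rw [h1, ← mul_assoc, ENNReal.inv_mul_cancel hc0 hct, one_mul]
  rw [he]
  have hp : Measurable fun P : AffGr d k => (P.1.direction.starProjection, P.foot) :=
    comap_measurable _
  exact (hG.lintegral_prod_right'.comp hp).const_mul _

/-- Almost every `k`-plane meets a null set in a null set. -/
lemma ae_restrict_null {d k : ℕ} (h : k ≤ d) {N : Set (E d)} (hN : MeasurableSet N)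
    (h0 : volume N = 0) :
    ∀ᵐ P ∂(sigma h), (euclideanHausdorffMeasure k).restrict (P.1 : Set (E d)) N = 0 := by
  have hm : Measurable (N.indicator (1 : E d → ℝ≥0∞)) := measurable_one.indicator hN
  have ht : ∀ P : AffGr d k, transform (N.indicator 1) P =
      (euclideanHausdorffMeasure k).restrict (P.1 : Set (E d)) N := fun P =>
    lintegral_indicator_one hN
  have hslab : ∀ W : Gr d k, slabIntegral (transform (N.indicator 1)) W = 0 := by
    intro W
    -- After the slab cutoff is dropped, Fubini puts the integral over `z ∈ ℝ^d` inside; for each `w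
    -- ∈ W` it is the measure of a translate of `N`.
    refine le_antisymm ((setLIntegral_le_lintegral _ _).trans ?_) zero_le
    simp_rw [transform_coset (N.indicator 1) W W.1.subtypeₗᵢ (by ext; simp)]
    have hm' : Measurable (Function.uncurry fun (z : E d) (w : W.1) =>
        N.indicator (1 : E d → ℝ≥0∞) (z + W.1.subtypeₗᵢ w)) :=
      hm.comp (measurable_fst.add (measurable_subtype_coe.comp measurable_snd))
    rw [lintegral_lintegral_swap hm'.aemeasurable]
    simp_rw [lintegral_add_right_eq_self (μ := (volume : Measure (E d))) (N.indicator 1)]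
    simp [lintegral_indicator_one hN, h0]
  have hint := lintegral_sigma_eq h (measurable_transform (k := k) hm)
  simp only [hslab, lintegral_zero, mul_eq_zero,
    (Metric.measure_closedBall_pos volume (0 : E k) one_pos).ne', false_or] at hint
  filter_upwards [(lintegral_eq_zero_iff (measurable_transform (k := k) hm)).mp hint] with P hP
  rw [← ht, hP]
  rfl

/-- Allows `f` to be replaced by a measurable representative, and makes the values of `S f` on `s =
0` irrelevant. -/
lemma transform_congr_ae {d k : ℕ} (h : k ≤ d) {f g : E d → ℝ≥0∞} (hfg : f =ᵐ[volume] g) :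
    transform f =ᵐ[sigma h] transform g := by
  obtain ⟨N, hN, hNm, h0⟩ := exists_measurable_superset_of_null hfg
  filter_upwards [ae_restrict_null h hNm h0] with P hP
  refine lintegral_congr_ae (measure_mono_null hN hP)

/-! ### Linear changes of variables -/

lemma lintegral_eq_abs_det_mul {V : Type*} [NormedAddCommGroup V] [NormedSpace ℝ V]
    [MeasurableSpace V] [BorelSpace V] [FiniteDimensional ℝ V] (μ : Measure V)
    [μ.IsAddHaarMeasure] {L : V →ₗ[ℝ] V} (hL : LinearMap.det L ≠ 0) {g : V → ℝ≥0∞}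
    (hg : Measurable g) :
    ∫⁻ x, g x ∂μ = ENNReal.ofReal |LinearMap.det L| * ∫⁻ x, g (L x) ∂μ := by
  have hLm : Measurable L := L.continuous_of_finiteDimensional.measurable
  rw [← lintegral_map hg hLm, map_linearMap_addHaar_eq_smul_addHaar μ hL, lintegral_smul_measure,
    smul_eq_mul, ← mul_assoc, ← ENNReal.ofReal_mul (abs_nonneg _), ← abs_mul, mul_inv_cancel₀ hL]
  simp

/-- The determinant of a `k`-tuple of vectors of `ℝ^k`. -/
noncomputable def detFrame {k : ℕ} (g : Fin k → E k) : ℝ :=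
  (Matrix.of fun j i => g j i).det

lemma detFrame_eq {k : ℕ} (g : Fin k → E k) :
    detFrame g = (EuclideanSpace.basisFun (Fin k) ℝ).toBasis.det g := by
  rw [Module.Basis.det_apply, ← Matrix.det_transpose, detFrame]
  congr 1

lemma detFrame_comp {k : ℕ} (L : E k →ₗ[ℝ] E k) (g : Fin k → E k) :
    detFrame (fun j => L (g j)) = LinearMap.det L * detFrame g := by
  rw [detFrame_eq, detFrame_eq, ← Module.Basis.det_comp]
  rfl

lemma continuous_detFrame {k : ℕ} : Continuous (detFrame : (Fin k → E k) → ℝ) := by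
  unfold detFrame
  refine Continuous.matrix_det (continuous_matrix fun j i => ?_)
  simp only [Matrix.of_apply]
  fun_prop

lemma linearIndependent_of_detFrame_ne_zero {k : ℕ} {g : Fin k → E k} (hg : detFrame g ≠ 0) :
    LinearIndependent ℝ g :=
  ((EuclideanSpace.basisFun (Fin k) ℝ).toBasis.is_basis_iff_det.mpr
    (by rw [← detFrame_eq]; exact hg.isUnit)).1

/-- On each line `g + t v`, with `v` the standard basis, the determinant is the characteristic
polynomial of `-G` at `t`, hence has finitely many zeros; the zero set in `(g, t)` is therefore
null. Its slices at fixed `t` are translates of the zero set of `detFrame`, so all have the same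
measure, which must vanish. -/
lemma ae_detFrame_ne_zero (k : ℕ) : ∀ᵐ g : Fin k → E k, detFrame g ≠ 0 := by
  let v : Fin k → E k := fun j => EuclideanSpace.single j 1
  have hcont : Continuous fun q : (Fin k → E k) × ℝ => detFrame (q.1 + q.2 • v) :=
    continuous_detFrame.comp (by fun_prop)
  have hD : MeasurableSet {q : (Fin k → E k) × ℝ | detFrame (q.1 + q.2 • v) = 0} :=
    measurableSet_eq_fun hcont.measurable measurable_const
  have h1 : ∀ g : Fin k → E k, volume {t : ℝ | detFrame (g + t • v) = 0} = 0 := by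
    intro g
    let G : Matrix (Fin k) (Fin k) ℝ := Matrix.of fun j i => g j i
    refine measure_mono_null (fun t ht => ?_)
      ((Polynomial.finite_setOfPred_isRoot (Matrix.charpoly_monic (-G)).ne_zero).measure_zero volume)
    have hM : Matrix.of (fun j i => (g + t • v) j i) = Matrix.scalar (Fin k) t - -G := by
      ext j i
      simp [G, v, Matrix.diagonal_apply, add_comm, eq_comm]
    change (Matrix.charpoly (-G)).eval t = 0
    rw [Matrix.eval_charpoly, ← hM]
    exact ht
  have h2 : ∀ t : ℝ, volume {g : Fin k → E k | detFrame (g + t • v) = 0} =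
      volume {g : Fin k → E k | detFrame g = 0} := fun t =>
    measure_preimage_add_right volume (t • v) {g : Fin k → E k | detFrame g = 0}
  have h3 : (volume : Measure ((Fin k → E k) × ℝ))
      {q : (Fin k → E k) × ℝ | detFrame (q.1 + q.2 • v) = 0} = 0 := by
    rw [volume_eq_prod, measure_prod_null hD]
    exact Filter.Eventually.of_forall h1
  rw [volume_eq_prod, prod_apply_symm hD] at h3
  have h4 : ∫⁻ _ : ℝ, volume {g : Fin k → E k | detFrame g = 0} = 0 := by
    rw [← h3]
    exact lintegral_congr fun t => (h2 t).symm
  rw [lintegral_const, Real.volume_univ, mul_eq_zero] at h4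
  rw [ae_iff]
  simpa using h4

/-! ### Planes as graphs -/

/-- The linear map with columns `A i`. -/
noncomputable def colMap {k m : ℕ} (A : Fin k → Fin m → ℝ) : E k →ₗ[ℝ] (Fin m → ℝ) where
  toFun y := ∑ i, y i • A i
  map_add' x y := by simp [add_smul, Finset.sum_add_distrib]
  map_smul' a x := by simp [mul_smul, Finset.smul_sum]

lemma colMap_apply {k m : ℕ} (A : Fin k → Fin m → ℝ) (y : E k) :
    colMap A y = ∑ i, y i • A i := rfl

lemma continuous_colMap {k m : ℕ} :
    Continuous fun q : (Fin k → Fin m → ℝ) × E k => colMap q.1 q.2 := by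
  simp only [colMap_apply]
  fun_prop

/-- Replacing the columns `A i` by the values at `k` vectors `g j` is a linear change of variables
of determinant `(det g)^m`. -/
lemma lintegral_columns {k m : ℕ} {g : Fin k → E k} (hg : detFrame g ≠ 0)
    {F : (Fin k → Fin m → ℝ) → ℝ≥0∞} (hF : Measurable F) :
    ∫⁻ A, F A = ENNReal.ofReal |detFrame g| ^ m * ∫⁻ A, F fun j => colMap A (g j) := by
  -- After transposition by `σ`, the map `L` is a product of `m` copies of the matrix `G`, one for
  -- each coordinate of `ℝ^m`; hence the determinant `(det g)^m`.
  let σ : (Fin m → Fin k → ℝ) ≃ₗ[ℝ] (Fin k → Fin m → ℝ) :=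
    { toFun := fun A i l => A l i
      invFun := fun A l i => A i l
      map_add' := fun _ _ => rfl
      map_smul' := fun _ _ => rfl
      left_inv := fun _ => rfl
      right_inv := fun _ => rfl }
  let G : Matrix (Fin k) (Fin k) ℝ := Matrix.of fun j i => g j i
  let L : (Fin k → Fin m → ℝ) →ₗ[ℝ] (Fin k → Fin m → ℝ) :=
    σ ∘ₗ (LinearMap.pi fun l : Fin m => Matrix.toLin' G ∘ₗ LinearMap.proj l) ∘ₗ σ.symm
  have hL : ∀ A, L A = fun j => colMap A (g j) := by
    intro A
    ext j l
    change Matrix.toLin' G (fun i => A i l) j = _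
    simp [Matrix.toLin'_apply, Matrix.mulVec, dotProduct, colMap_apply, G]
  have hdet : LinearMap.det L = detFrame g ^ m := by
    rw [LinearMap.det_conj, LinearMap.det_pi fun _ : Fin m => Matrix.toLin' G]
    simp [detFrame, G]
  have h := lintegral_eq_abs_det_mul volume (L := L) (by rw [hdet]; exact pow_ne_zero _ hg) hF
  rw [h, hdet, abs_pow, ENNReal.ofReal_pow (abs_nonneg _)]
  simp only [hL]

section Graph

variable {d k m : ℕ} (e : E d ≃ₗ[ℝ] (E k × (Fin m → ℝ)))

/-- The parametrization `y ↦ (y, A y)` of the graph of `A`, in the coordinates `e`. -/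
noncomputable def graphMap (A : Fin k → Fin m → ℝ) : E k →ₗ[ℝ] E d :=
  e.symm.toLinearMap ∘ₗ LinearMap.id.prod (colMap A)

lemma graphMap_apply (A : Fin k → Fin m → ℝ) (y : E k) :
    graphMap e A y = e.symm (y, colMap A y) := rfl

lemma graphMap_injective (A : Fin k → Fin m → ℝ) : Function.Injective (graphMap e A) := by
  intro x y h
  exact congrArg Prod.fst (e.symm.injective h)

lemma graphMap_add (A : Fin k → Fin m → ℝ) (y : E k) (b : Fin m → ℝ) :
    graphMap e A y + e.symm (0, b) = e.symm (y, colMap A y + b) := by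
  rw [graphMap_apply, ← map_add, Prod.mk_add_mk, add_zero]

/-- The graph of `A`, in the coordinates `e`. -/
noncomputable def graphGr (A : Fin k → Fin m → ℝ) : Gr d k :=
  ⟨LinearMap.range (graphMap e A), by
    rw [LinearMap.finrank_range_of_inj (graphMap_injective e A), finrank_euclideanSpace_fin]⟩

lemma continuous_graphMap :
    Continuous fun q : (Fin k → Fin m → ℝ) × E k => graphMap e q.1 q.2 :=
  (e.symm.toLinearMap.continuous_of_finiteDimensional).comp
    (continuous_snd.prodMk continuous_colMap)

lemma spanGr_graphMap (h : k ≤ d) (A : Fin k → Fin m → ℝ) {g : Fin k → E k}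
    (hg : LinearIndependent ℝ g) : spanGr h (fun j => graphMap e A (g j)) = graphGr e A := by
  have hX : LinearIndependent ℝ fun j => graphMap e A (g j) :=
    hg.map' _ (LinearMap.ker_eq_bot.mpr (graphMap_injective e A))
  refine Subtype.ext (Submodule.eq_of_le_of_finrank_eq ?_ ?_)
  · rw [spanGr_of_linearIndependent h hX, Submodule.span_le]
    rintro _ ⟨j, rfl⟩
    exact ⟨g j, rfl⟩
  · rw [(spanGr h _).2, (graphGr e A).2]

/-- The range of an injective linear map is parametrized isometrically by a linear change of
variables. -/
lemma exists_isometry_comp {T : E k →ₗ[ℝ] E d} (hT : Function.Injective T) :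
    ∃ (V : E k →ₗᵢ[ℝ] E d) (M : E k ≃ₗ[ℝ] E k), (∀ y, V y = T (M y)) ∧
      LinearMap.range V.toLinearMap = LinearMap.range T := by
  have hk : Module.finrank ℝ (LinearMap.range T) = k := by
    rw [LinearMap.finrank_range_of_inj hT, finrank_euclideanSpace_fin]
  let r : E k ≃ₗᵢ[ℝ] LinearMap.range T :=
    ((stdOrthonormalBasis ℝ (LinearMap.range T)).reindex (finCongr hk)).repr.symm
  let M : E k ≃ₗ[ℝ] E k := r.toLinearEquiv.trans (LinearEquiv.ofInjective T hT).symm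
  refine ⟨(LinearMap.range T).subtypeₗᵢ.comp r.toLinearIsometry, M, fun y => ?_, ?_⟩
  · have h : LinearEquiv.ofInjective T hT (M y) = r y := by simp [M]
    exact (congrArg Subtype.val h).symm
  · ext z
    constructor
    · rintro ⟨y, rfl⟩
      exact (r y).2
    · intro hz
      exact ⟨r.symm ⟨z, hz⟩, by simp⟩

/-- The factor by which an isometric parametrization of the graph of `A` differs from the
parametrization `y ↦ (y, A y)`. -/
lemma exists_graph_isometry (A : Fin k → Fin m → ℝ) :
    ∃ (V : E k →ₗᵢ[ℝ] E d) (M : E k ≃ₗ[ℝ] E k), (∀ y, V y = graphMap e A (M y)) ∧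
      LinearMap.range V.toLinearMap = (graphGr e A).1 :=
  exists_isometry_comp (graphMap_injective e A)

variable {e} {A : Fin k → Fin m → ℝ} {V : E k →ₗᵢ[ℝ] E d} {M : E k ≃ₗ[ℝ] E k}

lemma det_equiv_ne_zero (M : E k ≃ₗ[ℝ] E k) : LinearMap.det (M : E k →ₗ[ℝ] E k) ≠ 0 :=
  (LinearEquiv.isUnit_det' M).ne_zero

/-- Substitute `M y` for `y`: since `graphMap e A ∘ M` is an isometry, `|det M|⁻¹` is the area
factor of the graph parametrization. -/
lemma transform_graph (hV : ∀ y, V y = graphMap e A (M y))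
    (hr : LinearMap.range V.toLinearMap = (graphGr e A).1) {f : E d → ℝ≥0∞} (hf : Measurable f)
    (b : Fin m → ℝ) :
    ENNReal.ofReal |LinearMap.det (M : E k →ₗ[ℝ] E k)| *
        transform f ((graphGr e A).coset (e.symm (0, b))) =
      ∫⁻ y, f (e.symm (y, colMap A y + b)) := by
  have hm : Measurable fun y => f (e.symm (y, colMap A y + b)) := by
    simp only [← graphMap_add]
    exact hf.comp ((graphMap e A).continuous_of_finiteDimensional.measurable.add_const _)
  rw [lintegral_eq_abs_det_mul volume (det_equiv_ne_zero M) hm, transform_coset f _ V hr]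
  congr 1
  refine lintegral_congr fun y => ?_
  rw [← graphMap_add, hV, add_comm]
  rfl

lemma coset_add {W : Gr d k} {w : E d} (hw : w ∈ W.1) (x : E d) :
    W.coset (w + x) = W.coset x := by
  refine Subtype.ext (SetLike.coe_injective ?_)
  rw [coe_coset, coe_coset]
  ext z
  rw [Set.mem_ofPred_eq, Set.mem_ofPred_eq, add_comm w x, ← sub_sub]
  exact Submodule.sub_mem_iff_left _ hw

/-- Write a point as `(y, A y + b)`. Its coset depends on `b` alone, and for fixed `b` the
admissible `y` form the image under `M` of a translated unit ball, of volume `|det M|` times that of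
the ball. -/
lemma slabIntegral_graph (he : MeasurePreserving e volume volume)
    (hV : ∀ y, V y = graphMap e A (M y))
    (hr : LinearMap.range V.toLinearMap = (graphGr e A).1) {H : AffGr d k → ℝ≥0∞}
    (hH : Measurable H) :
    slabIntegral H (graphGr e A) = ENNReal.ofReal |LinearMap.det (M : E k →ₗ[ℝ] E k)| *
      volume (Metric.closedBall (0 : E k) 1) *
        ∫⁻ b, H ((graphGr e A).coset (e.symm (0, b))) := by
  let W := graphGr e A
  let G : E d → ℝ≥0∞ := {z : E d | ‖W.1.starProjection z‖ ≤ 1}.indicator fun z => H (W.coset z)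
  have hcoset : Measurable fun z : E d => W.coset z :=
    (measurable_coset d k).comp (measurable_const.prodMk measurable_id)
  have hG : Measurable G := (hH.comp hcoset).indicator (measurableSet_slab_section W)
  have hes : Continuous e.symm := e.symm.toLinearMap.continuous_of_finiteDimensional
  have hcol : Continuous (colMap A) := (colMap A).continuous_of_finiteDimensional
  have hGe : Measurable fun q : E k × (Fin m → ℝ) => G (e.symm q) := hG.comp hes.measurable
  have h1 : slabIntegral H W = ∫⁻ q : E k × (Fin m → ℝ), G (e.symm q) := by
    rw [← he.lintegral_comp hGe, slabIntegral,
      ← lintegral_indicator (measurableSet_slab_section W)]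
    simp only [LinearEquiv.symm_apply_apply]
    rfl
  have h2 : ∀ y : E k, ∫⁻ b, G (e.symm (y, b)) = ∫⁻ b, G (e.symm (y, colMap A y + b)) := fun y =>
    (lintegral_add_left_eq_self (fun b => G (e.symm (y, b))) (colMap A y)).symm
  have hm : Measurable fun q : E k × (Fin m → ℝ) => G (e.symm (q.1, colMap A q.1 + q.2)) :=
    hG.comp (hes.comp (continuous_fst.prodMk
      ((hcol.comp continuous_fst).add continuous_snd))).measurable
  have h3 : ∀ b, ∫⁻ y, G (e.symm (y, colMap A y + b)) =
      ENNReal.ofReal |LinearMap.det (M : E k →ₗ[ℝ] E k)| *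
        volume (Metric.closedBall (0 : E k) 1) * H (W.coset (e.symm (0, b))) := by
    intro b
    -- The projection of `(0, b)` is some `V u`, so its only effect is to shift the center of the
    -- ball to `-u`.
    obtain ⟨u, hu⟩ : W.1.starProjection (e.symm (0, b)) ∈ LinearMap.range V.toLinearMap := by
      rw [hr]; exact Submodule.starProjection_apply_mem _ _
    have hT : ∀ y, graphMap e A y ∈ W.1 := fun y => ⟨y, rfl⟩
    have h4 : ∀ y, G (e.symm (y, colMap A y + b)) =
        {y | ‖graphMap e A y + V u‖ ≤ 1}.indicator (fun _ => H (W.coset (e.symm (0, b)))) y := by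
      intro y
      have hp : W.1.starProjection (graphMap e A y + e.symm (0, b)) = graphMap e A y + V u := by
        rw [map_add, Submodule.starProjection_eq_self_iff.mpr (hT y), ← hu]
        rfl
      simp only [G, ← graphMap_add, Set.indicator, Set.mem_ofPred_eq, hp, coset_add (hT y)]
    have hTm : Measurable (graphMap e A) :=
      (graphMap e A).continuous_of_finiteDimensional.measurable
    have h5 : MeasurableSet {y | ‖graphMap e A y + V u‖ ≤ 1} :=
      measurableSet_le (hTm.add_const _).norm measurable_const
    simp_rw [h4]
    rw [lintegral_eq_abs_det_mul volume (det_equiv_ne_zero M) (measurable_const.indicator h5),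
      mul_assoc]
    congr 1
    have h6 : ∀ y, {y | ‖graphMap e A y + V u‖ ≤ 1}.indicator
        (fun _ => H (W.coset (e.symm (0, b)))) ((M : E k →ₗ[ℝ] E k) y) =
        (Metric.closedBall (0 : E k) 1).indicator
          (fun _ => H (W.coset (e.symm (0, b)))) (y + u) := by
      intro y
      have hn : ‖graphMap e A (M y) + V u‖ = ‖y + u‖ := by
        rw [← hV, ← map_add, V.norm_map]
      simp only [Set.indicator, Set.mem_ofPred_eq, LinearEquiv.coe_coe, hn, mem_closedBall_zero_iff]
    simp_rw [h6]
    rw [lintegral_add_right_eq_self (μ := volume) ((Metric.closedBall (0 : E k) 1).indicator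
          (fun _ => H (W.coset (e.symm (0, b))))) u, lintegral_indicator_const
            measurableSet_closedBall, mul_comm]
  have hb : Measurable fun b : Fin m → ℝ => H (W.coset (e.symm (0, b))) :=
    (hH.comp hcoset).comp (hes.comp (Continuous.prodMk_right 0)).measurable
  change slabIntegral H W = _
  rw [h1, volume_eq_prod, lintegral_prod _ hGe.aemeasurable]
  simp_rw [h2]
  rw [lintegral_lintegral_swap hm.aemeasurable]
  simp_rw [h3]
  rw [lintegral_const_mul _ hb]

end Graph

/-! ### The invariant measure in graph coordinates -/

section Graph

variable {d k m : ℕ} {e : E d ≃ₗ[ℝ] (E k × (Fin m → ℝ))}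

/-- Integration over `k`-tuples of vectors of `ℝ^d`, by means of the graph `A` of their span and of
their first components. -/
lemma lintegral_frames (he : MeasurePreserving e volume volume) {F : (Fin k → E d) → ℝ≥0∞}
    (hF : Measurable F) :
    ∫⁻ X, F X = ∫⁻ (A : Fin k → Fin m → ℝ), ∫⁻ (g : Fin k → E k),
      ENNReal.ofReal |detFrame g| ^ m * F fun j => graphMap e A (g j) := by
  have hes : Continuous e.symm := e.symm.toLinearMap.continuous_of_finiteDimensional
  have hpi : MeasurePreserving (fun (X : Fin k → E d) j => e (X j)) volume volume :=
    volume_preserving_pi fun _ => he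
  have hΘ := (volume_measurePreserving_arrowProdEquivProdArrow (E k) (Fin m → ℝ) (Fin k)).comp hpi
  have hF2 : Measurable fun q : (Fin k → E k) × (Fin k → Fin m → ℝ) =>
      F fun j => e.symm (q.1 j, q.2 j) :=
    hF.comp (Continuous.measurable (by fun_prop))
  have h1 : ∫⁻ X, F X = ∫⁻ q : (Fin k → E k) × (Fin k → Fin m → ℝ),
      F fun j => e.symm (q.1 j, q.2 j) := by
    rw [← hΘ.lintegral_comp hF2]
    refine lintegral_congr fun X => ?_
    congr 1
    funext j
    exact (e.symm_apply_apply (X j)).symm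
  -- For fixed invertible `g`, the second components `B j` are traded for the unique `A` with `A (g
  -- j) = B j`; singular `g` form a null set.
  have h2 : ∀ᵐ g : Fin k → E k, ∫⁻ B : Fin k → Fin m → ℝ, F (fun j => e.symm (g j, B j)) =
      ∫⁻ A : Fin k → Fin m → ℝ, ENNReal.ofReal |detFrame g| ^ m *
        F fun j => graphMap e A (g j) := by
    filter_upwards [ae_detFrame_ne_zero k] with g hg
    have hm : Measurable fun B : Fin k → Fin m → ℝ => F fun j => e.symm (g j, B j) :=
      hF.comp (Continuous.measurable (by fun_prop))
    rw [lintegral_columns hg hm, lintegral_const_mul]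
    · rfl
    · refine hF.comp (Continuous.measurable (continuous_pi fun j => ?_))
      exact (continuous_graphMap e).comp
        (f := fun A : Fin k → Fin m → ℝ => (A, g j)) (by fun_prop)
  rw [h1, volume_eq_prod, lintegral_prod _ hF2.aemeasurable, lintegral_congr_ae h2,
    lintegral_lintegral_swap]
  refine Measurable.aemeasurable (Measurable.mul ?_ ?_)
  · exact ((continuous_detFrame.comp continuous_fst).abs.measurable.ennreal_ofReal).pow_const _
  · refine hF.comp (Continuous.measurable (continuous_pi fun j => ?_))
    exact (continuous_graphMap e).comp
      (f := fun q : (Fin k → E k) × (Fin k → Fin m → ℝ) => (q.2, q.1 j)) (by fun_prop)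

/-- The integral of the `m`-th power of the determinant over the `k`-tuples of vectors whose images
under `T` are in the unit ball. -/
noncomputable def frameIntegral (m : ℕ) (T : E k →ₗ[ℝ] E d) : ℝ≥0∞ :=
  ∫⁻ g in {g : Fin k → E k | ∀ j, ‖T (g j)‖ ≤ 1}, ENNReal.ofReal |detFrame g| ^ m

lemma measurableSet_norm_comp_le (T : E k →ₗ[ℝ] E d) :
    MeasurableSet {g : Fin k → E k | ∀ j, ‖T (g j)‖ ≤ 1} := by
  rw [Set.ofPred_forall]
  have hT : Continuous T := T.continuous_of_finiteDimensional
  exact MeasurableSet.iInter fun j =>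
    measurableSet_le (hT.comp (continuous_apply j)).norm.measurable measurable_const

/-- Substitute `M (g j)` for `g j`: the `k` vectors contribute `|det M|^k`, the weight contributes
`|det M|^m`, and the constraint becomes `‖g j‖ ≤ 1`. -/
lemma frameIntegral_comp (m : ℕ) (T : E k →ₗ[ℝ] E d) (V : E k →ₗᵢ[ℝ] E d) (M : E k ≃ₗ[ℝ] E k)
    (hV : ∀ y, V y = T (M y)) :
    frameIntegral m T = ENNReal.ofReal |LinearMap.det (M : E k →ₗ[ℝ] E k)| ^ (k + m) *
      frameIntegral m (LinearMap.id : E k →ₗ[ℝ] E k) := by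
  let L : (Fin k → E k) →ₗ[ℝ] (Fin k → E k) :=
    LinearMap.pi fun j => (M : E k →ₗ[ℝ] E k) ∘ₗ LinearMap.proj j
  have hdet : LinearMap.det L = LinearMap.det (M : E k →ₗ[ℝ] E k) ^ k := by
    simp only [L, LinearMap.det_pi fun _ : Fin k => (M : E k →ₗ[ℝ] E k), Finset.prod_const,
      Finset.card_univ, Fintype.card_fin]
  have hd : Measurable fun g : Fin k → E k => ENNReal.ofReal |detFrame g| ^ m :=
    (continuous_detFrame.abs.measurable.ennreal_ofReal).pow_const _
  have hm := hd.indicator (measurableSet_norm_comp_le T)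
  have hm' := hd.indicator (measurableSet_norm_comp_le (LinearMap.id : E k →ₗ[ℝ] E k))
  rw [frameIntegral, frameIntegral, ← lintegral_indicator (measurableSet_norm_comp_le T),
    ← lintegral_indicator (measurableSet_norm_comp_le (LinearMap.id : E k →ₗ[ℝ] E k)),
    lintegral_eq_abs_det_mul volume (L := L) (by
      rw [hdet]; exact pow_ne_zero _ (det_equiv_ne_zero M)) hm, hdet, abs_pow,
    ENNReal.ofReal_pow (abs_nonneg _), pow_add, mul_assoc, ← lintegral_const_mul _ hm']
  congr 1
  refine lintegral_congr fun g => ?_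
  have hn : ∀ j, ‖T (L g j)‖ = ‖g j‖ := fun j => by
    rw [← V.norm_map, hV]
    rfl
  have hdg : detFrame (L g) = LinearMap.det (M : E k →ₗ[ℝ] E k) * detFrame g :=
    detFrame_comp (M : E k →ₗ[ℝ] E k) g
  by_cases hg : ∀ j, ‖g j‖ ≤ 1
  · simp [Set.indicator, hn, hg, hdg, abs_mul, ENNReal.ofReal_mul, mul_pow]
  · simp [Set.indicator, hn, hg]

/-- The frame `graphMap e A (g j)` spans the graph of `A` for every independent `g`, so `Φ` leaves
the integral over `g` and what remains is the density of `μ_k` in `A`. -/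
lemma lintegral_grMeasure_eq_graph (he : MeasurePreserving e volume volume) (h : k ≤ d)
    {Φ : Gr d k → ℝ≥0∞} (hΦ : Measurable Φ) :
    volume (unitFrames d k) * ∫⁻ W, Φ W ∂(grMeasure h) =
      ∫⁻ A : Fin k → Fin m → ℝ, Φ (graphGr e A) * frameIntegral m (graphMap e A) := by
  have hF : Measurable ((unitFrames d k).indicator fun X => Φ (spanGr h X)) :=
    (hΦ.comp (measurable_spanGr h)).indicator (measurableSet_unitFrames d k)
  rw [lintegral_grMeasure_eq h hΦ, ← lintegral_indicator (measurableSet_unitFrames d k),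
    lintegral_frames he hF]
  refine lintegral_congr fun A => ?_
  rw [frameIntegral, ← lintegral_indicator (measurableSet_norm_comp_le _), ← lintegral_const_mul]
  · refine lintegral_congr_ae ?_
    filter_upwards [ae_detFrame_ne_zero k] with g hg
    have hli := linearIndependent_of_detFrame_ne_zero hg
    have hX : LinearIndependent ℝ fun j => graphMap e A (g j) :=
      hli.map' _ (LinearMap.ker_eq_bot.mpr (graphMap_injective e A))
    by_cases hn : ∀ j, ‖graphMap e A (g j)‖ ≤ 1
    · simp [Set.indicator, unitFrames, hX, hn, spanGr_graphMap e h A hli, mul_comm]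
    · simp [Set.indicator, unitFrames, hn]
  · exact ((continuous_detFrame.abs.measurable.ennreal_ofReal).pow_const _).indicator
      (measurableSet_norm_comp_le _)

/-- The integral of `f (y, A y + b)` over `y`, in the coordinates `e`. -/
noncomputable def graphTransform (e : E d ≃ₗ[ℝ] (E k × (Fin m → ℝ))) (f : E d → ℝ≥0∞)
    (A : Fin k → Fin m → ℝ) (b : Fin m → ℝ) : ℝ≥0∞ :=
  ∫⁻ y, f (e.symm (y, colMap A y + b))

lemma measurable_graphTransform {f : E d → ℝ≥0∞} (hf : Measurable f) :
    Measurable fun q : (Fin k → Fin m → ℝ) × (Fin m → ℝ) => graphTransform e f q.1 q.2 := by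
  have hes : Continuous e.symm := e.symm.toLinearMap.continuous_of_finiteDimensional
  have hc : Continuous fun q : ((Fin k → Fin m → ℝ) × (Fin m → ℝ)) × E k =>
      e.symm (q.2, colMap q.1.1 q.2 + q.1.2) := by
    have := continuous_colMap.comp (f := fun q : ((Fin k → Fin m → ℝ) × (Fin m → ℝ)) × E k =>
      (q.1.1, q.2)) (by fun_prop)
    exact hes.comp (continuous_snd.prodMk (this.add (by fun_prop)))
  exact (hf.comp hc.measurable).lintegral_prod_right'

lemma add_eq_of_equiv (e : E d ≃ₗ[ℝ] (E k × (Fin m → ℝ))) : k + m = d := by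
  simpa using e.finrank_eq.symm

/-- In graph coordinates, the integral of the power `d + 1` of the transform is the integral of the
power `d + 1` of the unnormalized transform with respect to Lebesgue measure. -/
theorem lintegral_transform_pow (he : MeasurePreserving e volume volume) (h : k ≤ d)
    {f : E d → ℝ≥0∞} (hf : Measurable f) :
    volume (unitFrames d k) * volume (Metric.closedBall (0 : E k) 1) *
        ∫⁻ P, transform f P ^ (d + 1) ∂(sigma h) =
      volume (Metric.closedBall (0 : E k) 1) * frameIntegral m (LinearMap.id : E k →ₗ[ℝ] E k) *
        ∫⁻ (A : Fin k → Fin m → ℝ), ∫⁻ b, graphTransform e f A b ^ (d + 1) := by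
  have hH : Measurable fun P : AffGr d k => transform f P ^ (d + 1) :=
    (measurable_transform hf).pow_const _
  have hΨ : Measurable fun A : Fin k → Fin m → ℝ => ∫⁻ b, graphTransform e f A b ^ (d + 1) :=
    ((measurable_graphTransform hf).pow_const _).lintegral_prod_right'
  rw [mul_assoc, lintegral_sigma_eq h hH,
    lintegral_grMeasure_eq_graph he h (measurable_slabIntegral hH), ← lintegral_const_mul _ hΨ]
  refine lintegral_congr fun A => ?_
  obtain ⟨V, M, hV, hr⟩ := exists_graph_isometry e A
  have hb : Measurable fun b : Fin m → ℝ =>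
      transform f ((graphGr e A).coset (e.symm (0, b))) ^ (d + 1) := by
    have hes : Continuous e.symm := e.symm.toLinearMap.continuous_of_finiteDimensional
    exact hH.comp ((measurable_coset d k).comp
      (measurable_const.prodMk (hes.comp (Continuous.prodMk_right 0)).measurable))
  -- One factor `|det M|` comes from the slab and `k + m = d` from the density of `μ_k`; together
  -- they are absorbed into the power `d + 1` of the transform.
  rw [slabIntegral_graph he hV hr hH, frameIntegral_comp m _ V M hV, add_eq_of_equiv e]
  simp only [graphTransform, ← transform_graph hV hr hf, mul_pow]
  rw [lintegral_const_mul _ hb]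
  ring

end Graph

/-! ### The change of variables `(u, s) ↦ (u / s, 1 / s)` -/

lemma measurable_snoc {α : Type*} [MeasurableSpace α] (n : ℕ) :
    Measurable fun q : α × (Fin n → α) => (Fin.snoc q.2 q.1 : Fin (n + 1) → α) := by
  refine measurable_pi_iff.mpr fun i => ?_
  refine Fin.lastCases ?_ (fun i => ?_) i
  · simpa using measurable_fst
  · simpa [Function.comp_def] using
      (measurable_pi_apply i).comp (measurable_snd (α := α) (β := Fin n → α))

lemma lintegral_snoc {α : Type*} [MeasureSpace α] [SigmaFinite (volume : Measure α)] {n : ℕ}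
    {F : (Fin (n + 1) → α) → ℝ≥0∞} (hF : Measurable F) :
    ∫⁻ x, F x = ∫⁻ a, ∫⁻ x : Fin n → α, F (Fin.snoc x a) := by
  have hp := (volume_preserving_piFinSuccAbove (fun _ : Fin (n + 1) => α) (Fin.last n)).symm
  have hm : Measurable fun q : α × (Fin n → α) => F (Fin.snoc q.2 q.1) :=
    hF.comp (measurable_snoc n)
  rw [← lintegral_prod (fun q : α × (Fin n → α) => F (Fin.snoc q.2 q.1)) hm.aemeasurable,
    ← hp.lintegral_comp hF]
  refine lintegral_congr fun q => ?_
  congr 1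
  exact Fin.insertNth_last' q.1 q.2

lemma lintegral_inv_sq_mul {G : ℝ → ℝ≥0∞} :
    ∫⁻ s : ℝ, ENNReal.ofReal (1 / |s| ^ 2) * G (1 / s) = ∫⁻ s, G s := by
  have himg : (fun s : ℝ => s⁻¹) '' {0}ᶜ = {0}ᶜ := by
    ext s
    constructor
    · rintro ⟨t, ht, rfl⟩
      exact inv_ne_zero ht
    · intro hs
      exact ⟨s⁻¹, inv_ne_zero hs, inv_inv s⟩
  have hne : ({0}ᶜ : Set ℝ) =ᵐ[volume] Set.univ := by
    rw [ae_eq_univ]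
    simp
  have h := lintegral_image_eq_lintegral_abs_deriv_mul (s := ({0}ᶜ : Set ℝ))
    (f := fun s => s⁻¹) (f' := fun s => -(s ^ 2)⁻¹) (measurableSet_singleton 0).compl
    (fun x hx => (hasDerivAt_inv hx).hasDerivWithinAt) inv_injective.injOn G
  rw [himg, setLIntegral_congr hne, setLIntegral_congr hne, setLIntegral_univ,
    setLIntegral_univ] at h
  rw [h]
  simp

/-- The operator `S` for functions with values in `[0, ∞]`. -/
noncomputable def SENN {n : ℕ} (k : ℕ) (f : E (n + 1) → ℝ≥0∞) (x : E (n + 1)) : ℝ≥0∞ :=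
  ENNReal.ofReal (1 / |x (Fin.last n)| ^ (k + 1)) * f (inversion x)

lemma inversion_castSucc {n : ℕ} (x : E (n + 1)) (i : Fin n) :
    inversion x i.castSucc = x i.castSucc / x (Fin.last n) := by
  simp [inversion]

lemma inversion_last {n : ℕ} (x : E (n + 1)) :
    inversion x (Fin.last n) = 1 / x (Fin.last n) := by
  simp [inversion]

lemma inversion_inversion {n : ℕ} {x : E (n + 1)} (hx : x (Fin.last n) ≠ 0) :
    inversion (inversion x) = x := by
  ext i
  refine Fin.lastCases ?_ (fun i => ?_) i
  · rw [inversion_last, inversion_last, one_div_one_div]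
  · rw [inversion_castSucc, inversion_castSucc, inversion_last]
    field_simp

lemma measurable_inversion {n : ℕ} : Measurable (inversion : E (n + 1) → E (n + 1)) := by
  refine (WithLp.measurable_toLp 2 _).comp ?_
  refine (measurable_snoc n).comp
    (f := fun x : E (n + 1) => (1 / x (Fin.last n), fun i => x i.castSucc / x (Fin.last n))) ?_
  fun_prop

lemma measurable_SENN {n k : ℕ} {f : E (n + 1) → ℝ≥0∞} (hf : Measurable f) :
    Measurable (SENN k f) := by
  refine Measurable.mul ?_ (hf.comp measurable_inversion)
  fun_prop

lemma lintegral_euclidean_snoc {n : ℕ} {f : E (n + 1) → ℝ≥0∞} (hf : Measurable f) :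
    ∫⁻ x, f x = ∫⁻ s : ℝ, ∫⁻ u : Fin n → ℝ, f (WithLp.toLp 2 (Fin.snoc u s)) := by
  have hm : Measurable fun x : Fin (n + 1) → ℝ => f (WithLp.toLp 2 x) :=
    hf.comp (WithLp.measurable_toLp 2 _)
  rw [← (PiLp.volume_preserving_toLp (Fin (n + 1))).lintegral_comp hf, lintegral_snoc hm]

/-- The Jacobian is `|s|^(-n)` from `u / s` times `s^(-2)` from `1 / s`. As `SENN k` carries the
exponent `k + 1`, the parameter has to be `n + 1`, the dimension of the space. Applied on `ℝ^d` for
the isometry, and on the parameter space `ℝ^k` for the transform. -/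
lemma lintegral_SENN {n : ℕ} {f : E (n + 1) → ℝ≥0∞} (hf : Measurable f) :
    ∫⁻ x, SENN (n + 1) f x = ∫⁻ x, f x := by
  rw [lintegral_euclidean_snoc (measurable_SENN hf), lintegral_euclidean_snoc hf,
    ← lintegral_inv_sq_mul (G := fun s => ∫⁻ u : Fin n → ℝ, f (WithLp.toLp 2 (Fin.snoc u s)))]
  refine lintegral_congr_ae ?_
  have h0 : ∀ᵐ s : ℝ, s ≠ 0 := by simp [ae_iff]
  filter_upwards [h0] with s hs
  have hm : Measurable fun u : Fin n → ℝ => f (WithLp.toLp 2 (Fin.snoc u (1 / s))) :=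
    hf.comp ((WithLp.measurable_toLp 2 _).comp
      ((measurable_snoc n).comp (measurable_const.prodMk measurable_id)))
  have hdet : LinearMap.det (s⁻¹ • (LinearMap.id : (Fin n → ℝ) →ₗ[ℝ] (Fin n → ℝ))) = s⁻¹ ^ n := by
    simp
  have hL : ∀ u : Fin n → ℝ, inversion (WithLp.toLp 2 (Fin.snoc u s)) =
      WithLp.toLp 2 (Fin.snoc (s⁻¹ • u) (1 / s)) := by
    intro u
    ext i
    refine Fin.lastCases ?_ (fun i => ?_) i
    · simp [inversion_last]
    · simp [inversion_castSucc, div_eq_inv_mul]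
  rw [lintegral_eq_abs_det_mul volume
    (L := s⁻¹ • (LinearMap.id : (Fin n → ℝ) →ₗ[ℝ] (Fin n → ℝ)))
    (by rw [hdet]; exact pow_ne_zero _ (inv_ne_zero hs)) hm, hdet, ← mul_assoc,
    ← ENNReal.ofReal_mul (by positivity), ← lintegral_const_mul]
  · refine lintegral_congr fun u => ?_
    rw [SENN, hL]
    have hw : 1 / |(WithLp.toLp 2 (Fin.snoc u s : Fin (n + 1) → ℝ) : E (n + 1)) (Fin.last n)| ^
        (n + 1 + 1) = 1 / |s| ^ 2 * |s⁻¹ ^ n| := by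
      have : |s| ≠ 0 := abs_ne_zero.mpr hs
      simp only [Fin.snoc_last, abs_pow, abs_inv, inv_pow]
      field_simp
      ring
    rw [hw]
    rfl
  · exact hm.comp (LinearMap.continuous_of_finiteDimensional _).measurable

lemma ae_last_ne_zero (n : ℕ) : ∀ᵐ x : E (n + 1), x (Fin.last n) ≠ 0 := by
  have hs : MeasurableSet {x : E (n + 1) | x (Fin.last n) = 0} :=
    measurableSet_eq_fun (by fun_prop) measurable_const
  have h := lintegral_euclidean_snoc (n := n) (measurable_one.indicator hs :
    Measurable ({x : E (n + 1) | x (Fin.last n) = 0}.indicator (1 : E (n + 1) → ℝ≥0∞)))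
  rw [lintegral_indicator_one hs] at h
  rw [ae_iff]
  simp only [ne_eq, not_not]
  rw [h, lintegral_eq_zero_iff' ?_]
  · have h0 : ∀ᵐ s : ℝ, s ≠ 0 := by simp [ae_iff]
    filter_upwards [h0] with s hs
    simp [Set.indicator, hs]
  · have : Measurable fun q : ℝ × (Fin n → ℝ) =>
        {x : E (n + 1) | x (Fin.last n) = 0}.indicator (1 : E (n + 1) → ℝ≥0∞)
          (WithLp.toLp 2 (Fin.snoc q.2 q.1)) :=
      (measurable_one.indicator hs).comp ((WithLp.measurable_toLp 2 _).comp (measurable_snoc n))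
    exact this.lintegral_prod_right'.aemeasurable

/-- Apply the change of variables to the indicator of a null set: the weight is positive off `s =
0`, so the preimage is null. This is what makes `S` well defined on classes of functions. -/
lemma quasiMeasurePreserving_inversion (n : ℕ) :
    QuasiMeasurePreserving (inversion : E (n + 1) → E (n + 1)) volume volume := by
  refine ⟨measurable_inversion, AbsolutelyContinuous.mk fun N hN h0 => ?_⟩
  have hm : Measurable (N.indicator (1 : E (n + 1) → ℝ≥0∞)) := measurable_one.indicator hN
  have h := lintegral_SENN hm
  rw [lintegral_indicator_one hN, h0, lintegral_eq_zero_iff (measurable_SENN hm)] at h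
  rw [map_apply measurable_inversion hN]
  refine measure_eq_zero_iff_ae_notMem.mpr ?_
  filter_upwards [h, ae_last_ne_zero n] with x hx hs hxN
  have hpos : 0 < 1 / |x (Fin.last n)| ^ (n + 1 + 1) := by
    have := abs_pos.mpr hs
    positivity
  have hi : N.indicator (1 : E (n + 1) → ℝ≥0∞) (inversion x) = 1 :=
    Set.indicator_of_mem (s := N) hxN _
  rw [SENN, hi, mul_one] at hx
  exact (ENNReal.ofReal_pos.mpr hpos).ne' hx

lemma SENN_congr_ae {n k : ℕ} {f g : E (n + 1) → ℝ≥0∞} (h : f =ᵐ[volume] g) :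
    SENN k f =ᵐ[volume] SENN k g := by
  filter_upwards [(quasiMeasurePreserving_inversion n).ae h] with x hx
  rw [SENN, SENN, hx]

lemma lintegral_SENN' {n : ℕ} {f : E (n + 1) → ℝ≥0∞} (hf : AEMeasurable f) :
    ∫⁻ x, SENN (n + 1) f x = ∫⁻ x, f x := by
  rw [lintegral_congr_ae (SENN_congr_ae hf.ae_eq_mk), lintegral_SENN hf.measurable_mk,
    lintegral_congr_ae hf.ae_eq_mk]

/-! ### The isometry of `L^p` -/

lemma S_congr_ae {n k : ℕ} {f g : E (n + 1) → ℝ} (h : f =ᵐ[volume] g) :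
    S k f =ᵐ[volume] S k g := by
  filter_upwards [(quasiMeasurePreserving_inversion n).ae h] with x hx
  rw [S, S, hx]

lemma aestronglyMeasurable_S {n : ℕ} (k : ℕ) {f : E (n + 1) → ℝ}
    (hf : AEStronglyMeasurable f) : AEStronglyMeasurable (S k f) := by
  have hw : Measurable fun x : E (n + 1) => 1 / |x (Fin.last n)| ^ (k + 1) := by fun_prop
  exact hw.aestronglyMeasurable.mul
    (hf.comp_quasiMeasurePreserving (quasiMeasurePreserving_inversion n))

lemma S_S {n k : ℕ} (f : E (n + 1) → ℝ) : S k (S k f) =ᵐ[volume] f := by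
  filter_upwards [ae_last_ne_zero n] with x hx
  have h : |x (Fin.last n)| ≠ 0 := abs_ne_zero.mpr hx
  rw [S, S, inversion_inversion hx, inversion_last, ← mul_assoc]
  have hw : 1 / |x (Fin.last n)| ^ (k + 1) * (1 / |1 / x (Fin.last n)| ^ (k + 1)) = 1 := by
    rw [abs_div, abs_one, one_div_pow, one_div_one_div, one_div_mul_cancel (pow_ne_zero _ h)]
  rw [hw, one_mul]

lemma pExp_toReal (d k : ℕ) : (pExp d k).toReal = ((d : ℝ) + 1) / ((k : ℝ) + 1) := by
  rw [pExp, ENNReal.toReal_div, ENNReal.toReal_add (by simp) (by simp),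
    ENNReal.toReal_add (by simp) (by simp)]
  simp

lemma pExp_ne_top (d k : ℕ) : pExp d k ≠ ∞ :=
  ENNReal.div_ne_top (by simp) (by simp)

lemma pExp_ne_zero (d k : ℕ) : pExp d k ≠ 0 :=
  (ENNReal.div_pos (by simp) (by simp)).ne'

/-- The exponent is chosen so that `(k + 1) p = d + 1`; hence `|S f|^p` is `|f|^p` composed with the
inversion, times the Jacobian. -/
lemma eLpNorm_S {n k : ℕ} {f : E (n + 1) → ℝ} (hf : AEStronglyMeasurable f) :
    eLpNorm (S k f) (pExp (n + 1) k) volume = eLpNorm f (pExp (n + 1) k) volume := by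
  have hp : 0 ≤ (pExp (n + 1) k).toReal := ENNReal.toReal_nonneg
  rw [eLpNorm_eq_lintegral_rpow_enorm_toReal (pExp_ne_zero _ _) (pExp_ne_top _ _),
    eLpNorm_eq_lintegral_rpow_enorm_toReal (pExp_ne_zero _ _) (pExp_ne_top _ _),
    ← lintegral_SENN' (hf.enorm.pow_const _)]
  congr 1
  refine lintegral_congr fun x => ?_
  rw [SENN, S, enorm_mul, ENNReal.mul_rpow_of_nonneg _ _ hp, Real.enorm_of_nonneg (by positivity),
    ENNReal.ofReal_rpow_of_nonneg (by positivity) hp]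
  congr 2
  rw [Real.div_rpow zero_le_one (by positivity), Real.one_rpow, pExp_toReal,
    ← Real.rpow_natCast, ← Real.rpow_mul (abs_nonneg _), ← Real.rpow_natCast]
  congr 2
  push_cast
  field_simp

lemma memLp_S {n k : ℕ} {f : E (n + 1) → ℝ} (hf : MemLp f (pExp (n + 1) k)) :
    MemLp (S k f) (pExp (n + 1) k) :=
  ⟨aestronglyMeasurable_S k hf.1, by rw [eLpNorm_S hf.1]; exact hf.2⟩

/-- The linear map of `L^p` induced by `S`. -/
noncomputable def SLp (n k : ℕ) :
    Lp ℝ (pExp (n + 1) k) (volume : Measure (E (n + 1))) →ₗ[ℝ]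
      Lp ℝ (pExp (n + 1) k) (volume : Measure (E (n + 1))) where
  toFun f := (memLp_S (Lp.memLp f)).toLp (S k f)
  map_add' f g := by
    rw [← MemLp.toLp_add]
    refine MemLp.toLp_congr _ _ ((S_congr_ae (Lp.coeFn_add f g)).trans ?_)
    exact Filter.Eventually.of_forall fun x => by simp [S, mul_add]
  map_smul' a f := by
    rw [RingHom.id_apply, ← MemLp.toLp_const_smul]
    refine MemLp.toLp_congr _ _ ((S_congr_ae (Lp.coeFn_smul a f)).trans ?_)
    exact Filter.Eventually.of_forall fun x => by simp [S]; ring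

lemma SLp_ae_eq (n k : ℕ) (f : Lp ℝ (pExp (n + 1) k) (volume : Measure (E (n + 1)))) :
    SLp n k f =ᵐ[volume] S k f :=
  MemLp.coeFn_toLp (memLp_S (Lp.memLp f))

lemma SLp_involutive (n k : ℕ) : Function.Involutive (SLp n k) := fun f =>
  Lp.ext ((SLp_ae_eq n k _).trans ((S_congr_ae (SLp_ae_eq n k f)).trans (S_S _)))

/-- The operator `S` induces a linear isometry of `L^p` onto itself. -/
theorem exists_isometry_S (n k : ℕ) [Fact (1 ≤ pExp (n + 1) k)] :
    ∃ T : Lp ℝ (pExp (n + 1) k) (volume : Measure (E (n + 1))) ≃ₗᵢ[ℝ]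
        Lp ℝ (pExp (n + 1) k) (volume : Measure (E (n + 1))),
      ∀ (f : E (n + 1) → ℝ) (hf : MemLp f (pExp (n + 1) k) volume),
        T (hf.toLp f) =ᵐ[volume] S k f := by
  refine ⟨⟨LinearEquiv.ofInvolutive (SLp n k) (SLp_involutive n k), fun f => ?_⟩, fun f hf => ?_⟩
  · change ‖(memLp_S (Lp.memLp f)).toLp (S k f)‖ = ‖f‖
    rw [Lp.norm_toLp, Lp.norm_def, eLpNorm_S (Lp.memLp f).1]
  · exact (SLp_ae_eq n k (hf.toLp f)).trans (S_congr_ae hf.coeFn_toLp)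

/-! ### Invariance of the norm of the transform -/

/-- The splitting of `ℝ^(m+j+1)` into the last `j + 1` and the first `m` coordinates. -/
noncomputable def splitEquiv (m j : ℕ) : E (m + j + 1) ≃ₗ[ℝ] (E (j + 1) × (Fin m → ℝ)) where
  toFun x := (WithLp.toLp 2 fun i => x (Fin.natAdd m i), fun l => x (Fin.castAdd (j + 1) l))
  invFun q := WithLp.toLp 2 (Fin.append (m := m) (n := j + 1) q.2 q.1)
  map_add' _ _ := rfl
  map_smul' _ _ := rfl
  left_inv x := by
    ext i
    refine Fin.addCases (m := m) (n := j + 1) (fun l => ?_) (fun l => ?_) i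
    · exact Fin.append_left _ _ l
    · exact Fin.append_right _ _ l
  right_inv q := by
    refine Prod.ext ?_ ?_
    · ext l
      exact Fin.append_right _ _ l
    · ext l
      exact Fin.append_left _ _ l

lemma measurePreserving_splitEquiv (m j : ℕ) :
    MeasurePreserving (splitEquiv m j) volume volume := by
  have h1 : MeasurePreserving (fun x : E (m + j + 1) => x.ofLp) volume volume :=
    PiLp.volume_preserving_ofLp (Fin (m + j + 1))
  have h2 := (volume_measurePreserving_piCongrLeft (fun _ : Fin (m + (j + 1)) => ℝ)
    (finSumFinEquiv (m := m) (n := j + 1))).symm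
  have h3 := volume_measurePreserving_sumPiEquivProdPi fun _ : Fin m ⊕ Fin (j + 1) => ℝ
  have h4 : MeasurePreserving (Prod.swap : (Fin m → ℝ) × (Fin (j + 1) → ℝ) → _) volume volume :=
    measurePreserving_swap
  have h5 : MeasurePreserving (fun q : (Fin (j + 1) → ℝ) × (Fin m → ℝ) =>
      ((WithLp.toLp 2 q.1 : E (j + 1)), q.2)) volume volume :=
    (PiLp.volume_preserving_toLp (Fin (j + 1))).prod (MeasurePreserving.id volume)
  exact h5.comp (h4.comp (h3.comp (h2.comp h1)))

/-- The reason for taking the last `j + 1` coordinates as parameters: `s` must be one of them. -/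
lemma splitEquiv_symm_last (m j : ℕ) (q : E (j + 1) × (Fin m → ℝ)) :
    (splitEquiv m j).symm q (Fin.last (m + j)) = q.1 (Fin.last j) :=
  Fin.append_right (m := m) (n := j + 1) q.2 q.1 (Fin.last j)

lemma inversion_splitEquiv_symm (m j : ℕ) (y : E (j + 1)) (z : Fin m → ℝ) :
    inversion ((splitEquiv m j).symm (y, z)) =
      (splitEquiv m j).symm (inversion y, (y (Fin.last j))⁻¹ • z) := by
  ext i
  refine Fin.addCases (m := m) (n := j + 1) (fun l => ?_) (fun l => ?_) i
  · have h1 : (splitEquiv m j).symm (inversion y, (y (Fin.last j))⁻¹ • z)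
        (Fin.castAdd (j + 1) l) = (y (Fin.last j))⁻¹ • z l := Fin.append_left _ _ l
    have h2 : (splitEquiv m j).symm (y, z) (Fin.castAdd (j + 1) l) = z l := Fin.append_left _ _ l
    have h3 : Fin.castAdd (j + 1) l = (Fin.castAdd j l).castSucc := rfl
    rw [h1, h3, inversion_castSucc, ← h3, h2, splitEquiv_symm_last, smul_eq_mul, div_eq_inv_mul]
  · have h1 : (splitEquiv m j).symm (inversion y, (y (Fin.last j))⁻¹ • z)
        (Fin.natAdd m l) = inversion y l := Fin.append_right _ _ l
    have h2 : ∀ l, (splitEquiv m j).symm (y, z) (Fin.natAdd m l) = y l := fun l =>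
      Fin.append_right _ _ l
    rw [h1]
    refine Fin.lastCases ?_ (fun l => ?_) l
    · exact (inversion_last _).trans (by rw [splitEquiv_symm_last, inversion_last])
    · have h3 : Fin.natAdd m l.castSucc = (Fin.natAdd m l).castSucc := rfl
      rw [h3, inversion_castSucc, ← h3, h2, splitEquiv_symm_last, inversion_castSucc]

lemma colMap_snoc {j m : ℕ} (A : Fin j → Fin m → ℝ) (a : Fin m → ℝ) (y : E (j + 1)) :
    colMap (Fin.snoc A a) y = ∑ i : Fin j, y i.castSucc • A i + y (Fin.last j) • a := by
  simp [colMap_apply, Fin.sum_univ_castSucc]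

/-- In graph coordinates, the operator `S` interchanges the last column and the constant term. -/
lemma graphTransform_SENN {m j : ℕ} {f : E (m + j + 1) → ℝ≥0∞} (hf : Measurable f)
    (A : Fin j → Fin m → ℝ) (a b : Fin m → ℝ) :
    graphTransform (splitEquiv m j) (SENN (j + 1) f) (Fin.snoc A a) b =
      graphTransform (splitEquiv m j) f (Fin.snoc A b) a := by
  have hc : Continuous fun y : E (j + 1) =>
      (splitEquiv m j).symm (y, colMap (Fin.snoc A b) y + a) :=
    ((splitEquiv m j).symm.toLinearMap.continuous_of_finiteDimensional).comp
      (continuous_id.prodMk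
        ((colMap (Fin.snoc A b)).continuous_of_finiteDimensional.add continuous_const))
  have hm : Measurable fun y : E (j + 1) =>
      f ((splitEquiv m j).symm (y, colMap (Fin.snoc A b) y + a)) := hf.comp hc.measurable
  -- The weight of `S` on `ℝ^d` is exactly the Jacobian of the inversion of the parameter space
  -- `ℝ^(j+1)`.
  rw [graphTransform, graphTransform, ← lintegral_SENN hm]
  refine lintegral_congr_ae ?_
  filter_upwards [ae_last_ne_zero j] with y hy
  -- Division by `s` frees the column `a` of its factor `s` and gives the constant term `b` the
  -- factor `1 / s`, the last coordinate of `inversion y`.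
  have hz : (y (Fin.last j))⁻¹ • (colMap (Fin.snoc A a) y + b) =
      colMap (Fin.snoc A b) (inversion y) + a := by
    rw [colMap_snoc, colMap_snoc, inversion_last, smul_add, smul_add, smul_smul,
      inv_mul_cancel₀ hy, one_smul, Finset.smul_sum, one_div, add_assoc, add_assoc,
      add_comm a]
    congr 1
    refine Finset.sum_congr rfl fun i _ => ?_
    rw [smul_smul, inversion_castSucc, div_eq_inv_mul]
  rw [SENN, SENN, splitEquiv_symm_last, inversion_splitEquiv_symm, hz]

/-- The last column and the constant term both range over `ℝ^m` with Lebesgue measure; with the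
other columns integrated innermost, exchanging the two is Tonelli. -/
lemma lintegral_graphTransform_SENN {m j : ℕ} {f : E (m + j + 1) → ℝ≥0∞} (hf : Measurable f)
    (p : ℕ) :
    ∫⁻ (A : Fin (j + 1) → Fin m → ℝ), ∫⁻ b,
        graphTransform (splitEquiv m j) (SENN (j + 1) f) A b ^ p =
      ∫⁻ (A : Fin (j + 1) → Fin m → ℝ), ∫⁻ b, graphTransform (splitEquiv m j) f A b ^ p := by
  have hΨ : ∀ {g : E (m + j + 1) → ℝ≥0∞}, Measurable g →
      Measurable fun q : (Fin (j + 1) → Fin m → ℝ) × (Fin m → ℝ) =>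
        graphTransform (splitEquiv m j) g q.1 q.2 ^ p := fun hg =>
    (measurable_graphTransform hg).pow_const _
  let G : (Fin m → ℝ) → (Fin m → ℝ) → ℝ≥0∞ := fun a b =>
    ∫⁻ A : Fin j → Fin m → ℝ, graphTransform (splitEquiv m j) f (Fin.snoc A a) b ^ p
  have hs : Measurable fun q : ((Fin m → ℝ) × (Fin m → ℝ)) × (Fin j → Fin m → ℝ) =>
      ((Fin.snoc q.2 q.1.1 : Fin (j + 1) → Fin m → ℝ), q.1.2) := by
    refine Measurable.prodMk ?_ (measurable_snd.comp measurable_fst)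
    exact (measurable_snoc j).comp
      (f := fun q : ((Fin m → ℝ) × (Fin m → ℝ)) × (Fin j → Fin m → ℝ) => (q.1.1, q.2))
      ((measurable_fst.comp measurable_fst).prodMk measurable_snd)
  have key : ∀ {g : E (m + j + 1) → ℝ≥0∞}, Measurable g →
      ∫⁻ (A : Fin (j + 1) → Fin m → ℝ), ∫⁻ b, graphTransform (splitEquiv m j) g A b ^ p =
        ∫⁻ a, ∫⁻ b, ∫⁻ A : Fin j → Fin m → ℝ,
          graphTransform (splitEquiv m j) g (Fin.snoc A a) b ^ p := by
    intro g hg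
    rw [lintegral_snoc (hΨ hg).lintegral_prod_right']
    refine lintegral_congr fun a => lintegral_lintegral_swap (Measurable.aemeasurable ?_)
    exact (hΨ hg).comp (hs.comp (f := fun q : (Fin j → Fin m → ℝ) × (Fin m → ℝ) =>
      ((a, q.2), q.1)) (by fun_prop))
  have hG : Measurable (Function.uncurry G) := ((hΨ hf).comp hs).lintegral_prod_right'
  rw [key (measurable_SENN hf), key hf]
  simp_rw [graphTransform_SENN hf]
  exact lintegral_lintegral_swap (f := fun a b => G b a)
    (hG.comp measurable_swap).aemeasurable

lemma lintegral_transform_SENN {m j : ℕ} (h : j + 1 ≤ m + j + 1) {f : E (m + j + 1) → ℝ≥0∞}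
    (hf : AEMeasurable f) :
    ∫⁻ P, transform (SENN (j + 1) f) P ^ (m + j + 1 + 1) ∂(sigma h) =
      ∫⁻ P, transform f P ^ (m + j + 1 + 1) ∂(sigma h) := by
  have hc : ∀ {g₁ g₂ : E (m + j + 1) → ℝ≥0∞}, g₁ =ᵐ[volume] g₂ →
      ∫⁻ P, transform g₁ P ^ (m + j + 1 + 1) ∂(sigma h) =
        ∫⁻ P, transform g₂ P ^ (m + j + 1 + 1) ∂(sigma h) := fun hg =>
    lintegral_congr_ae ((transform_congr_ae h hg).fun_comp (· ^ (m + j + 1 + 1)))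
  rw [hc (SENN_congr_ae hf.ae_eq_mk), hc hf.ae_eq_mk]
  have he := measurePreserving_splitEquiv m j
  have h0 : volume (unitFrames (m + j + 1) (j + 1)) *
      volume (Metric.closedBall (0 : E (j + 1)) 1) ≠ 0 :=
    mul_ne_zero (volume_unitFrames_ne_zero h)
      (Metric.measure_closedBall_pos volume _ one_pos).ne'
  have ht : volume (unitFrames (m + j + 1) (j + 1)) *
      volume (Metric.closedBall (0 : E (j + 1)) 1) ≠ ∞ :=
    ENNReal.mul_ne_top (volume_unitFrames_ne_top _ _) measure_closedBall_lt_top.ne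
  -- Only the constant on the left of `lintegral_transform_pow` has to be cancelled; the one on the
  -- right is the same for `f` and for its image.
  rw [← ENNReal.mul_right_inj h0 ht,
    lintegral_transform_pow he h (measurable_SENN hf.measurable_mk),
    lintegral_transform_pow he h hf.measurable_mk,
    lintegral_graphTransform_SENN hf.measurable_mk]

lemma ofReal_S {n k : ℕ} (f : E (n + 1) → ℝ) (x : E (n + 1)) :
    ENNReal.ofReal (S k f x) = SENN k (fun x => ENNReal.ofReal (f x)) x := by
  rw [S, SENN, ENNReal.ofReal_mul (by positivity)]

end KPlane

theorem mainTheorem4 (n k : ℕ) (hk : 1 ≤ k) (hkn : k ≤ n) :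
    (haveI : Fact (1 ≤ KPlane.pExp (n + 1) k) := ⟨KPlane.one_le_pExp (Nat.le_succ_of_le hkn)⟩
      ∃ T : Lp ℝ (KPlane.pExp (n + 1) k) (volume : Measure (KPlane.E (n + 1))) ≃ₗᵢ[ℝ]
          Lp ℝ (KPlane.pExp (n + 1) k) (volume : Measure (KPlane.E (n + 1))),
        ∀ (f : KPlane.E (n + 1) → ℝ) (hf : MemLp f (KPlane.pExp (n + 1) k) volume),
          T (hf.toLp f) =ᵐ[volume] KPlane.S k f) ∧
    ∀ f : KPlane.E (n + 1) → ℝ, AEMeasurable f volume → (∀ x, 0 ≤ f x) →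
      eLpNorm (KPlane.transform fun x => ENNReal.ofReal (KPlane.S k f x))
          (((n + 1 : ℕ) : ℝ≥0∞) + 1) (KPlane.sigma (Nat.le_succ_of_le hkn)) =
        eLpNorm (KPlane.transform fun x => ENNReal.ofReal (f x))
          (((n + 1 : ℕ) : ℝ≥0∞) + 1) (KPlane.sigma (Nat.le_succ_of_le hkn)) := by
  refine ⟨?_, fun f hf _ => ?_⟩
  · have : Fact (1 ≤ KPlane.pExp (n + 1) k) := ⟨KPlane.one_le_pExp (Nat.le_succ_of_le hkn)⟩
    exact KPlane.exists_isometry_S n k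
  -- Positivity of `k` leaves at least one parameter of the graph to play the role of `s`.
  obtain ⟨j, rfl⟩ : ∃ j, k = j + 1 := ⟨k - 1, by omega⟩
  obtain ⟨m, rfl⟩ : ∃ m, n = m + j := ⟨n - j, by omega⟩
  have hp : ((m + j + 1 : ℕ) : ℝ≥0∞) + 1 = ((m + j + 1 + 1 : ℕ) : ℝ≥0∞) := by push_cast; rfl
  have hp0 : ((m + j + 1 + 1 : ℕ) : ℝ≥0∞) ≠ 0 := by simp
  rw [hp, eLpNorm_eq_lintegral_rpow_enorm_toReal hp0 (ENNReal.natCast_ne_top _),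
    eLpNorm_eq_lintegral_rpow_enorm_toReal hp0 (ENNReal.natCast_ne_top _)]
  simp only [enorm_eq_self, ENNReal.toReal_natCast, ENNReal.rpow_natCast, KPlane.ofReal_S]
  rw [KPlane.lintegral_transform_SENN (Nat.le_succ_of_le hkn) hf.ennreal_ofReal]
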